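/- All algebras are associative algebras over $\mathbb{C}$, not necessarily unital. Write $A\sqcup B$ for the free product of two algebras without identification of units, $A*B$ for the free product of two unital algebras with identification of units, and $\widetilde{A}=\mathbb{C}1\oplus A$ for the unitization of $A$, so that $\widetilde{A}*\widetilde{B}\simeq\widetilde{A\sqcup B}$. **Conditionally bi-free product.** For $k=1,2$ let $B_{k,\ell},B_{k,r}$ be unital algebras and let $\varphi_k,\psi_k$ be unital linear functionals on $B_k:=B_{k,\ell}*B_{k,r}$. Regard $X_k=B_k=\mathbb{C}1\oplus X_k^\circ$, $X_k^\circ=\ker\psi_k$, as a vector space with specified vector $\xi=1$. Let $X=\mathbb{C}\xi\oplus\bigoplus_{n\ge1}\bigoplus_{k_1\ne k_2\ne\cdots\ne k_n}X_{k_1}^\circ\otimes\cdots\otimes X_{k_n}^\circ$ be their free product. An operator $T$ on $X_k$ acts on $X$ from the left, $\lambda_k(T)$, on the first tensor factor (via $X\simeq X_k\otimes X(\ell,k)$, where $X(\ell,k)$ is spanned by $\xi$ and the tensors not starting in $X_k^\circ$), and from the right, $\rho_k(T)$, on the last tensor factor (via $X\simeq X(r,k)\otimes X_k$). Let $\pi:B_1*B_2\to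 L(X)$ be the unital homomorphism which sends $b\in B_{k,\ell}$ to $\lambda_k$, and $b\in B_{k,r}$ to $\rho_k$, of the operator of left multiplication by $b$ on $X_k$. Let $\Psi,\Phi:X\to\mathbb{C}$ be the linear functionals with $\Psi(\xi)=\Phi(\xi)=1$, $\Psi(x_1\otimes\cdots\otimes x_n)=0$ and $\Phi(x_1\otimes\cdots\otimes x_n)=\varphi_{k_1}(x_1)\cdots\varphi_{k_n}(x_n)$ for $x_j\in X_{k_j}^\circ$, $n\geq 1$. The c-bi-free product $(\varphi,\psi)=(\varphi_1,\psi_1)*\!*(\varphi_2,\psi_2)$ is the pair of unital functionals $\varphi(b)=\Phi(\pi(b)\xi)$, $\psi(b)=\Psi(\pi(b)\xi)$ on $B_1*B_2$. **Bi-monotonic product (type I).** For $k=1,2$ let $(A_{k,\ell},A_{k,r})$ be a pair of algebras and $\varphi_k:A_{k,\ell}\sqcup A_{k,r}\to\mathbb{C}$ a linear functional. Let $\widetilde{\varphi_k}$ be the unital linear extension of $\varphi_k$ to $\widetilde{A_{k,\ell}}*\widetilde{A_{k,r}}\simeq\widetilde{A_{k,\ell}\sqcup A_{k,r}}$, and let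 $\delta_1$ be the functional $\lambda1+a\mapsto\lambda$ on $\widetilde{A_{1,\ell}\sqcup A_{1,r}}$. The bi-monotonic product $\varphi_1\rhd\!\!\rhd\varphi_2$ is the restriction to $(A_{1,\ell}\sqcup A_{1,r})\sqcup(A_{2,\ell}\sqcup A_{2,r})$ of the first coordinate of the c-bi-free product $(\widetilde{\varphi_1},\delta_1)*\!*(\widetilde{\varphi_2},\widetilde{\varphi_2})$. Via the canonical isomorphism $(A_{1,\ell}\sqcup A_{1,r})\sqcup(A_{2,\ell}\sqcup A_{2,r})\simeq(A_{1,\ell}\sqcup A_{2,\ell})\sqcup(A_{1,r}\sqcup A_{2,r})$ it is a linear functional for the pair of algebras $(A_{1,\ell}\sqcup A_{2,\ell},\,A_{1,r}\sqcup A_{2,r})$. **Theorem.** The type I bi-monotonic product is associative: for all pairs of algebras $(A_{k,\ell},A_{k,r})$ and all linear functionals $\varphi_k:A_{k,\ell}\sqcup A_{k,r}\to\mathbb{C}$, $k=1,2,3$, $$(\varphi_1\rhd\!\!\rhd\varphi_2)\rhd\!\!\rhd\varphi_3=\varphi_1\rhd\!\!\rhd(\varphi_2\rhd\!\!\rhd\varphi_3),$$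 where the two sides are functionals for the pairs $((A_{1,s}\sqcup A_{2,s})\sqcup A_{3,s})_{s=\ell,r}$ and $(A_{1,s}\sqcup(A_{2,s}\sqcup A_{3,s}))_{s=\ell,r}$, which are identified by the canonical isomorphisms. -/

import Mathlib

noncomputable section

namespace BiMono

open scoped TensorProduct

universe u v w u' v' w'

/-! ## The free product of unital algebras (with identification of units) -/

section FreeProd

variable (A : Type u) (B : Type v) [Ring A] [Algebra ℂ A] [Ring B] [Algebra ℂ B]

/-- The relations which make the two inclusions of `A` and `B` unital and multiplicative. -/
inductive FreeProdRel : TensorAlgebra ℂ (A × B) → TensorAlgebra ℂ (A × B) → Prop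
  | one_left : FreeProdRel (TensorAlgebra.ι ℂ (1, 0)) 1
  | one_right : FreeProdRel (TensorAlgebra.ι ℂ (0, 1)) 1
  | mul_left (a a' : A) : FreeProdRel
      (TensorAlgebra.ι ℂ (a * a', 0)) (TensorAlgebra.ι ℂ (a, 0) * TensorAlgebra.ι ℂ (a', 0))
  | mul_right (b b' : B) : FreeProdRel
      (TensorAlgebra.ι ℂ (0, b * b')) (TensorAlgebra.ι ℂ (0, b) * TensorAlgebra.ι ℂ (0, b'))

/-- The free product `A * B` of two unital complex algebras, with identification of units
(the coproduct in the category of unital complex algebras). -/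
def FreeProd : Type (max u v) := RingQuot (FreeProdRel A B)

instance : Ring (FreeProd A B) := inferInstanceAs (Ring (RingQuot (FreeProdRel A B)))

instance : Algebra ℂ (FreeProd A B) := inferInstanceAs (Algebra ℂ (RingQuot (FreeProdRel A B)))

namespace FreeProd

/-- The quotient map. -/
def mk : TensorAlgebra ℂ (A × B) →ₐ[ℂ] FreeProd A B := RingQuot.mkAlgHom ℂ (FreeProdRel A B)

variable {A B}

theorem mk_rel {x y : TensorAlgebra ℂ (A × B)} (h : FreeProdRel A B x y) :
    mk A B x = mk A B y := RingQuot.mkAlgHom_rel ℂ h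

/-- The canonical homomorphism `A → A * B`. -/
def inl : A →ₐ[ℂ] FreeProd A B :=
  AlgHom.ofLinearMap ((mk A B).toLinearMap ∘ₗ TensorAlgebra.ι ℂ ∘ₗ LinearMap.inl ℂ A B)
    (by simpa using mk_rel (A := A) (B := B) .one_left)
    (fun a a' => by simpa using mk_rel (A := A) (B := B) (.mul_left a a'))

/-- The canonical homomorphism `B → A * B`. -/
def inr : B →ₐ[ℂ] FreeProd A B :=
  AlgHom.ofLinearMap ((mk A B).toLinearMap ∘ₗ TensorAlgebra.ι ℂ ∘ₗ LinearMap.inr ℂ A B)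
    (by simpa using mk_rel (A := A) (B := B) .one_right)
    (fun b b' => by simpa using mk_rel (A := A) (B := B) (.mul_right b b'))

variable {C : Type w} [Ring C] [Algebra ℂ C]

/-- The homomorphism `A * B → C` induced by homomorphisms `A → C` and `B → C`. -/
def lift (f : A →ₐ[ℂ] C) (g : B →ₐ[ℂ] C) : FreeProd A B →ₐ[ℂ] C :=
  RingQuot.liftAlgHom ℂ ⟨TensorAlgebra.lift ℂ (f.toLinearMap.coprod g.toLinearMap), by
    intro x y h
    cases h <;> simp⟩

theorem lift_mk (f : A →ₐ[ℂ] C) (g : B →ₐ[ℂ] C) (t : TensorAlgebra ℂ (A × B)) :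
    lift f g (mk A B t) = TensorAlgebra.lift ℂ (f.toLinearMap.coprod g.toLinearMap) t :=
  RingQuot.liftAlgHom_mkAlgHom_apply _ _ _ _

@[simp] theorem lift_inl (f : A →ₐ[ℂ] C) (g : B →ₐ[ℂ] C) (a : A) : lift f g (inl a) = f a := by
  change lift f g (mk A B (TensorAlgebra.ι ℂ (a, 0))) = f a
  simp [lift_mk]

@[simp] theorem lift_inr (f : A →ₐ[ℂ] C) (g : B →ₐ[ℂ] C) (b : B) : lift f g (inr b) = g b := by
  change lift f g (mk A B (TensorAlgebra.ι ℂ (0, b))) = g b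
  simp [lift_mk]

end FreeProd

end FreeProd

/-! ## The free product of algebras without identification of units -/

section NUFreeProd

variable (A : Type u) (B : Type v)
  [NonUnitalRing A] [Module ℂ A] [IsScalarTower ℂ A A] [SMulCommClass ℂ A A]
  [NonUnitalRing B] [Module ℂ B] [IsScalarTower ℂ B B] [SMulCommClass ℂ B B]

/-- The non-unital subalgebra of the unital free product of the unitizations of `A` and `B` which
is generated by `A` and `B`. -/
def nuFreeProdSubalgebra :
    NonUnitalSubalgebra ℂ (FreeProd (Unitization ℂ A) (Unitization ℂ B)) :=
  NonUnitalAlgebra.adjoin ℂ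
    (Set.range (fun a : A => FreeProd.inl (B := Unitization ℂ B) (a : Unitization ℂ A)) ∪
      Set.range (fun b : B => FreeProd.inr (A := Unitization ℂ A) (b : Unitization ℂ B)))

/-- The free product `A ⊔ B` of two (not necessarily unital) complex algebras, without
identification of units (the coproduct in the category of non-unital complex algebras). -/
def NUFreeProd : Type (max u v) := nuFreeProdSubalgebra A B

instance : NonUnitalRing (NUFreeProd A B) :=
  inferInstanceAs (NonUnitalRing (nuFreeProdSubalgebra A B))

instance : Module ℂ (NUFreeProd A B) := inferInstanceAs (Module ℂ (nuFreeProdSubalgebra A B))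

instance : IsScalarTower ℂ (NUFreeProd A B) (NUFreeProd A B) :=
  inferInstanceAs (IsScalarTower ℂ (nuFreeProdSubalgebra A B) (nuFreeProdSubalgebra A B))

instance : SMulCommClass ℂ (NUFreeProd A B) (NUFreeProd A B) :=
  inferInstanceAs (SMulCommClass ℂ (nuFreeProdSubalgebra A B) (nuFreeProdSubalgebra A B))

namespace NUFreeProd

/-- The inclusion of `A ⊔ B` into the unital free product of the unitizations. -/
def incl : NUFreeProd A B →ₙₐ[ℂ] FreeProd (Unitization ℂ A) (Unitization ℂ B) :=
  NonUnitalSubalgebraClass.subtype (nuFreeProdSubalgebra A B)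

variable {A B}

/-- The canonical homomorphism `A → A ⊔ B`. -/
def inl : A →ₙₐ[ℂ] NUFreeProd A B :=
  NonUnitalAlgHom.codRestrict
    ((FreeProd.inl (B := Unitization ℂ B)).toNonUnitalAlgHom.comp
      (Unitization.inrNonUnitalAlgHom ℂ A))
    (nuFreeProdSubalgebra A B)
    (fun a => NonUnitalAlgebra.subset_adjoin ℂ (Or.inl ⟨a, rfl⟩))

/-- The canonical homomorphism `B → A ⊔ B`. -/
def inr : B →ₙₐ[ℂ] NUFreeProd A B :=
  NonUnitalAlgHom.codRestrict
    ((FreeProd.inr (A := Unitization ℂ A)).toNonUnitalAlgHom.comp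
      (Unitization.inrNonUnitalAlgHom ℂ B))
    (nuFreeProdSubalgebra A B)
    (fun b => NonUnitalAlgebra.subset_adjoin ℂ (Or.inr ⟨b, rfl⟩))

variable {C : Type w} [NonUnitalRing C] [Module ℂ C]

theorem hom_ext {f g : NUFreeProd A B →ₙₐ[ℂ] C} (hl : ∀ a, f (inl a) = g (inl a))
    (hr : ∀ b, f (inr b) = g (inr b)) : f = g := by
  ext x
  obtain ⟨x, hx⟩ := x
  induction hx using NonUnitalAlgebra.adjoin_induction with
  | mem x hx =>
    rcases hx with ⟨a, rfl⟩ | ⟨a, rfl⟩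
    · exact hl a
    · exact hr a
  | add x y hx hy h h' =>
    exact (map_add f (⟨x, hx⟩ : NUFreeProd A B) ⟨y, hy⟩).trans
      ((congrArg₂ _ h h').trans (map_add g (⟨x, hx⟩ : NUFreeProd A B) ⟨y, hy⟩).symm)
  | zero => exact (map_zero f).trans (map_zero g).symm
  | mul x y hx hy h h' =>
    exact (map_mul f (⟨x, hx⟩ : NUFreeProd A B) ⟨y, hy⟩).trans
      ((congrArg₂ _ h h').trans (map_mul g (⟨x, hx⟩ : NUFreeProd A B) ⟨y, hy⟩).symm)
  | smul r x hx h =>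
    exact (map_smul f r (⟨x, hx⟩ : NUFreeProd A B)).trans
      ((congrArg _ h).trans (map_smul g r (⟨x, hx⟩ : NUFreeProd A B)).symm)

variable [IsScalarTower ℂ C C] [SMulCommClass ℂ C C]

/-- The unital homomorphism from the free product of the unitizations of `A` and `B` to the
unitization of `C` which is induced by homomorphisms `A → C` and `B → C`. -/
def unitalLift (f : A →ₙₐ[ℂ] C) (g : B →ₙₐ[ℂ] C) :
    FreeProd (Unitization ℂ A) (Unitization ℂ B) →ₐ[ℂ] Unitization ℂ C :=
  FreeProd.lift (Unitization.lift ((Unitization.inrNonUnitalAlgHom ℂ C).comp f))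
    (Unitization.lift ((Unitization.inrNonUnitalAlgHom ℂ C).comp g))

theorem fst_unitalLift (f : A →ₙₐ[ℂ] C) (g : B →ₙₐ[ℂ] C) (x : NUFreeProd A B) :
    (unitalLift f g (incl A B x)).fst = 0 := by
  obtain ⟨x, hx⟩ := x
  change (unitalLift f g x).fst = 0
  induction hx using NonUnitalAlgebra.adjoin_induction with
  | mem x hx =>
    rcases hx with ⟨a, rfl⟩ | ⟨a, rfl⟩ <;> simp [unitalLift]
  | add x y _ _ hx hy => simp [hx, hy]
  | zero => simp
  | mul x y _ _ hx hy => simp [hx]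
  | smul r x _ hx => simp [hx]

/-- The homomorphism `A ⊔ B → C` induced by homomorphisms `A → C` and `B → C`. -/
def lift (f : A →ₙₐ[ℂ] C) (g : B →ₙₐ[ℂ] C) : NUFreeProd A B →ₙₐ[ℂ] C where
  toFun x := (unitalLift f g (incl A B x)).snd
  map_smul' c x := by simp
  map_zero' := by simp
  map_add' x y := by simp
  map_mul' x y := by simp [fst_unitalLift]

@[simp] theorem lift_inl (f : A →ₙₐ[ℂ] C) (g : B →ₙₐ[ℂ] C) (a : A) : lift f g (inl a) = f a := by
  change (unitalLift f g (FreeProd.inl (a : Unitization ℂ A))).snd = f a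
  simp [unitalLift]

@[simp] theorem lift_inr (f : A →ₙₐ[ℂ] C) (g : B →ₙₐ[ℂ] C) (b : B) : lift f g (inr b) = g b := by
  change (unitalLift f g (FreeProd.inr (b : Unitization ℂ B))).snd = g b
  simp [unitalLift]

end NUFreeProd

end NUFreeProd

section Identifications

variable (A : Type u) (B : Type v) (C : Type w) (D : Type u')
  [NonUnitalRing A] [Module ℂ A] [IsScalarTower ℂ A A] [SMulCommClass ℂ A A]
  [NonUnitalRing B] [Module ℂ B] [IsScalarTower ℂ B B] [SMulCommClass ℂ B B]
  [NonUnitalRing C] [Module ℂ C] [IsScalarTower ℂ C C] [SMulCommClass ℂ C C]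
  [NonUnitalRing D] [Module ℂ D] [IsScalarTower ℂ D D] [SMulCommClass ℂ D D]

namespace NUFreeProd

/-- The canonical identification `(A ⊔ B) ⊔ (C ⊔ D) ≃ (A ⊔ C) ⊔ (B ⊔ D)`. -/
def regroup : NUFreeProd (NUFreeProd A B) (NUFreeProd C D) →ₙₐ[ℂ]
    NUFreeProd (NUFreeProd A C) (NUFreeProd B D) :=
  lift (lift (inl.comp inl) (inr.comp inl)) (lift (inl.comp inr) (inr.comp inr))

theorem regroup_regroup (x : NUFreeProd (NUFreeProd A B) (NUFreeProd C D)) :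
    regroup A C B D (regroup A B C D x) = x := by
  have : (regroup A C B D).comp (regroup A B C D) = NonUnitalAlgHom.id ℂ _ := by
    apply hom_ext
    · exact DFunLike.congr_fun (hom_ext (f := ((regroup A C B D).comp (regroup A B C D)).comp inl)
        (g := inl) (by simp [regroup]) (by simp [regroup]))
    · exact DFunLike.congr_fun (hom_ext (f := ((regroup A C B D).comp (regroup A B C D)).comp inr)
        (g := inr) (by simp [regroup]) (by simp [regroup]))
  exact DFunLike.congr_fun this x

theorem regroup_bijective : Function.Bijective (regroup A B C D) :=
  Function.bijective_iff_has_inverse.2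
    ⟨regroup A C B D, regroup_regroup A B C D, regroup_regroup A C B D⟩

/-- The canonical identification `(A ⊔ B) ⊔ C ≃ A ⊔ (B ⊔ C)`. -/
def assoc : NUFreeProd (NUFreeProd A B) C →ₙₐ[ℂ] NUFreeProd A (NUFreeProd B C) :=
  lift (lift inl (inr.comp inl)) (inr.comp inr)

/-- The inverse of `assoc`. -/
def assocInv : NUFreeProd A (NUFreeProd B C) →ₙₐ[ℂ] NUFreeProd (NUFreeProd A B) C :=
  lift (inl.comp inl) (lift (inl.comp inr) inr)

theorem assocInv_assoc (x : NUFreeProd (NUFreeProd A B) C) :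
    assocInv A B C (assoc A B C x) = x := by
  have : (assocInv A B C).comp (assoc A B C) = NonUnitalAlgHom.id ℂ _ := by
    apply hom_ext
    · exact DFunLike.congr_fun (hom_ext (f := ((assocInv A B C).comp (assoc A B C)).comp inl)
        (g := inl) (by simp [assoc, assocInv]) (by simp [assoc, assocInv]))
    · simp [assoc, assocInv]
  exact DFunLike.congr_fun this x

theorem assoc_assocInv (x : NUFreeProd A (NUFreeProd B C)) :
    assoc A B C (assocInv A B C x) = x := by
  have : (assoc A B C).comp (assocInv A B C) = NonUnitalAlgHom.id ℂ _ := by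
    apply hom_ext
    · simp [assoc, assocInv]
    · exact DFunLike.congr_fun (hom_ext (f := ((assoc A B C).comp (assocInv A B C)).comp inr)
        (g := inr) (by simp [assoc, assocInv]) (by simp [assoc, assocInv]))
  exact DFunLike.congr_fun this x

theorem assoc_bijective : Function.Bijective (assoc A B C) :=
  Function.bijective_iff_has_inverse.2
    ⟨assocInv A B C, assocInv_assoc A B C, assoc_assocInv A B C⟩

variable (L₁ : Type u) (L₂ : Type v) (L₃ : Type w) (R₁ : Type u') (R₂ : Type v') (R₃ : Type w')
  [NonUnitalRing L₁] [Module ℂ L₁] [IsScalarTower ℂ L₁ L₁] [SMulCommClass ℂ L₁ L₁]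
  [NonUnitalRing L₂] [Module ℂ L₂] [IsScalarTower ℂ L₂ L₂] [SMulCommClass ℂ L₂ L₂]
  [NonUnitalRing L₃] [Module ℂ L₃] [IsScalarTower ℂ L₃ L₃] [SMulCommClass ℂ L₃ L₃]
  [NonUnitalRing R₁] [Module ℂ R₁] [IsScalarTower ℂ R₁ R₁] [SMulCommClass ℂ R₁ R₁]
  [NonUnitalRing R₂] [Module ℂ R₂] [IsScalarTower ℂ R₂ R₂] [SMulCommClass ℂ R₂ R₂]
  [NonUnitalRing R₃] [Module ℂ R₃] [IsScalarTower ℂ R₃ R₃] [SMulCommClass ℂ R₃ R₃]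

/-- The identification of the pairs of algebras `((L₁ ⊔ L₂) ⊔ L₃, (R₁ ⊔ R₂) ⊔ R₃)` and
`(L₁ ⊔ (L₂ ⊔ L₃), R₁ ⊔ (R₂ ⊔ R₃))`, on the level of the free products of the left and the
right algebra. -/
def pairAssoc :
    NUFreeProd (NUFreeProd (NUFreeProd L₁ L₂) L₃) (NUFreeProd (NUFreeProd R₁ R₂) R₃) →ₙₐ[ℂ]
      NUFreeProd (NUFreeProd L₁ (NUFreeProd L₂ L₃)) (NUFreeProd R₁ (NUFreeProd R₂ R₃)) :=
  lift (inl.comp (assoc L₁ L₂ L₃)) (inr.comp (assoc R₁ R₂ R₃))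

theorem pairAssoc_bijective : Function.Bijective (pairAssoc L₁ L₂ L₃ R₁ R₂ R₃) := by
  refine Function.bijective_iff_has_inverse.2
    ⟨lift (inl.comp (assocInv L₁ L₂ L₃)) (inr.comp (assocInv R₁ R₂ R₃)), fun x => ?_, fun x => ?_⟩
  · refine DFunLike.congr_fun (f := NonUnitalAlgHom.comp (lift _ _) (pairAssoc L₁ L₂ L₃ R₁ R₂ R₃))
      (g := NonUnitalAlgHom.id ℂ _) ?_ x
    apply hom_ext <;> simp [pairAssoc, assocInv_assoc]
  · refine DFunLike.congr_fun (f := NonUnitalAlgHom.comp (pairAssoc L₁ L₂ L₃ R₁ R₂ R₃) (lift _ _))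
      (g := NonUnitalAlgHom.id ℂ _) ?_ x
    apply hom_ext <;> simp [pairAssoc, assoc_assocInv]

end NUFreeProd

end Identifications

/-! ## Reduced free products of vector spaces with a specified vector -/

/-- A complex vector space `X` with a specified vector `ξ` and a specified linear functional
`p` with `p ξ = 1`; equivalently, a decomposition `X = ℂ ξ ⊕ X°` with `X° = ker p`. -/
structure PtSpace (X : Type u) [AddCommGroup X] [Module ℂ X] where
  vec : X
  state : X →ₗ[ℂ] ℂ
  state_vec : state vec = 1

namespace PtSpace

variable {X : Type u} [AddCommGroup X] [Module ℂ X] (S : PtSpace X)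

/-- The complement `X°` of the specified vector. -/
abbrev Kernel : Type u := LinearMap.ker S.state

/-- The projection `x ↦ x° = x - p(x) ξ` of `X` onto `X°`. -/
def proj : X →ₗ[ℂ] S.Kernel :=
  LinearMap.codRestrict _ (LinearMap.id - S.state.smulRight S.vec)
    (fun x => by simp [S.state_vec])

theorem coe_proj (x : X) : (S.proj x : X) = x - S.state x • S.vec := rfl

@[simp] theorem proj_vec : S.proj S.vec = 0 := by ext; simp [coe_proj, S.state_vec]

@[simp] theorem proj_kernel (x : S.Kernel) : S.proj x = x := by ext; simp [coe_proj]

end PtSpace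

section RedFree

variable {X : Type u} [AddCommGroup X] [Module ℂ X] {Z : Type v} [AddCommGroup Z] [Module ℂ Z]

/-- The relations which kill the words with two adjacent letters in `X°` or two adjacent letters
in `Z°`. -/
inductive RedFreeRel (S : PtSpace X) (T : PtSpace Z) :
    TensorAlgebra ℂ (S.Kernel × T.Kernel) → TensorAlgebra ℂ (S.Kernel × T.Kernel) → Prop
  | left (x x' : S.Kernel) : RedFreeRel S T
      (TensorAlgebra.ι ℂ (x, 0) * TensorAlgebra.ι ℂ (x', 0)) 0
  | right (z z' : T.Kernel) : RedFreeRel S T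
      (TensorAlgebra.ι ℂ (0, z) * TensorAlgebra.ι ℂ (0, z')) 0

/-- The free product of the vector spaces with specified vectors `X = ℂ ξ ⊕ X°` and
`Z = ℂ ξ ⊕ Z°`, that is, the direct sum of `ℂ ξ` and of all alternating tensor products
`X°`, `Z°`, `X° ⊗ Z°`, `Z° ⊗ X°`, `X° ⊗ Z° ⊗ X°`, ....

It is realized as the quotient of the tensor algebra of `X° ⊕ Z°` by the ideal generated by
`X° ⊗ X°` and `Z° ⊗ Z°`: the tensor algebra is the direct sum of all tensor words in `X°` and `Z°`,
and the ideal is the sum of those words which are not alternating. The product of this quotient is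
the concatenation of tensors (zero when the result is not alternating), and its unit is the
specified vector `ξ`. -/
def RedFree (S : PtSpace X) (T : PtSpace Z) : Type (max u v) := RingQuot (RedFreeRel S T)

variable (S : PtSpace X) (T : PtSpace Z)

instance : Ring (RedFree S T) := inferInstanceAs (Ring (RingQuot (RedFreeRel S T)))

instance : Algebra ℂ (RedFree S T) := inferInstanceAs (Algebra ℂ (RingQuot (RedFreeRel S T)))

namespace RedFree

/-- The quotient map. -/
def mk : TensorAlgebra ℂ (S.Kernel × T.Kernel) →ₐ[ℂ] RedFree S T :=
  RingQuot.mkAlgHom ℂ (RedFreeRel S T)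

/-- A vector of `X°`, as a tensor of length one. -/
def inl : S.Kernel →ₗ[ℂ] RedFree S T :=
  (mk S T).toLinearMap ∘ₗ TensorAlgebra.ι ℂ ∘ₗ LinearMap.inl ℂ S.Kernel T.Kernel

/-- A vector of `Z°`, as a tensor of length one. -/
def inr : T.Kernel →ₗ[ℂ] RedFree S T :=
  (mk S T).toLinearMap ∘ₗ TensorAlgebra.ι ℂ ∘ₗ LinearMap.inr ℂ S.Kernel T.Kernel

@[simp] theorem inl_mul_inl (x x' : S.Kernel) : inl S T x * inl S T x' = 0 := by
  change mk S T (TensorAlgebra.ι ℂ (x, 0)) * mk S T (TensorAlgebra.ι ℂ (x', 0)) = 0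
  rw [← map_mul, ← map_zero (mk S T)]
  exact RingQuot.mkAlgHom_rel ℂ (RedFreeRel.left x x')

@[simp] theorem inr_mul_inr (z z' : T.Kernel) : inr S T z * inr S T z' = 0 := by
  change mk S T (TensorAlgebra.ι ℂ (0, z)) * mk S T (TensorAlgebra.ι ℂ (0, z')) = 0
  rw [← map_mul, ← map_zero (mk S T)]
  exact RingQuot.mkAlgHom_rel ℂ (RedFreeRel.right z z')

variable {S T}

section Lift

variable {C : Type w} [Ring C] [Algebra ℂ C]

/-- The universal property of the algebra of alternating tensors. -/
def lift (f : S.Kernel →ₗ[ℂ] C) (g : T.Kernel →ₗ[ℂ] C) (hf : ∀ x x', f x * f x' = 0)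
    (hg : ∀ z z', g z * g z' = 0) : RedFree S T →ₐ[ℂ] C :=
  RingQuot.liftAlgHom ℂ ⟨TensorAlgebra.lift ℂ (f.coprod g), by
    intro x y h
    cases h <;> simp [hf, hg]⟩

variable (f : S.Kernel →ₗ[ℂ] C) (g : T.Kernel →ₗ[ℂ] C) (hf : ∀ x x', f x * f x' = 0)
    (hg : ∀ z z', g z * g z' = 0)

theorem lift_mk (t : TensorAlgebra ℂ (S.Kernel × T.Kernel)) :
    lift f g hf hg (mk S T t) = TensorAlgebra.lift ℂ (f.coprod g) t :=
  RingQuot.liftAlgHom_mkAlgHom_apply _ _ _ _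

@[simp] theorem lift_inl (x : S.Kernel) : lift f g hf hg (inl S T x) = f x := by
  change lift f g hf hg (mk S T (TensorAlgebra.ι ℂ (x, 0))) = f x
  simp [lift_mk]

@[simp] theorem lift_inr (z : T.Kernel) : lift f g hf hg (inr S T z) = g z := by
  change lift f g hf hg (mk S T (TensorAlgebra.ι ℂ (0, z))) = g z
  simp [lift_mk]

theorem hom_ext {f g : RedFree S T →ₐ[ℂ] C} (hl : ∀ x, f (inl S T x) = g (inl S T x))
    (hr : ∀ z, f (inr S T z) = g (inr S T z)) : f = g := by
  apply RingQuot.ringQuot_ext'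
  apply TensorAlgebra.hom_ext
  apply LinearMap.prod_ext
  · ext x; exact hl x
  · ext z; exact hr z

end Lift

/-- Induction on words. -/
theorem word_induction {P : RedFree S T → Prop} (one : P 1) (add : ∀ a b, P a → P b → P (a + b))
    (smul : ∀ (c : ℂ) a, P a → P (c • a)) (left : ∀ x a, P a → P (inl S T x * a))
    (right : ∀ z a, P a → P (inr S T z * a)) (a : RedFree S T) : P a := by
  obtain ⟨t, rfl⟩ := RingQuot.mkAlgHom_surjective ℂ (RedFreeRel S T) a
  suffices h : ∀ t b, P b → P (mk S T t * b) by
    have := h t 1 one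
    rwa [mul_one] at this
  intro t
  induction t using TensorAlgebra.induction with
  | algebraMap r =>
    intro b hb
    rw [AlgHom.commutes, ← Algebra.smul_def]
    exact smul _ _ hb
  | ι m =>
    intro b hb
    have : mk S T (TensorAlgebra.ι ℂ m) = inl S T m.1 + inr S T m.2 := by
      simp only [inl, inr, LinearMap.comp_apply, ← map_add]
      simp
    rw [this, add_mul]
    exact add _ _ (left _ _ hb) (right _ _ hb)
  | mul s t hs ht =>
    intro b hb
    rw [map_mul, mul_assoc]
    exact hs _ (ht _ hb)
  | add s t hs ht =>
    intro b hb
    rw [map_add, add_mul]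
    exact add _ _ (hs _ hb) (ht _ hb)

variable (S T)

/-- Exchange of the roles of `X` and `Z`. -/
def swapHom : RedFree S T →ₐ[ℂ] RedFree T S :=
  lift (inr T S) (inl T S) (by simp) (by simp)

theorem swapHom_swapHom (a : RedFree S T) : swapHom T S (swapHom S T a) = a := by
  have : (swapHom T S).comp (swapHom S T) = AlgHom.id ℂ _ := by
    apply hom_ext <;> simp [swapHom]
  exact DFunLike.congr_fun this a

/-- Exchange of the roles of `X` and `Z`, as a linear isomorphism. -/
def swap : RedFree S T ≃ₗ[ℂ] RedFree T S :=
  LinearEquiv.ofLinearMap (swapHom S T).toLinearMap (swapHom T S).toLinearMap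
    (LinearMap.ext (swapHom_swapHom T S)) (LinearMap.ext (swapHom_swapHom S T))

/-- The reversal of words, as a homomorphism to the opposite algebra. -/
def revHom : RedFree S T →ₐ[ℂ] (RedFree S T)ᵐᵒᵖ :=
  lift ((MulOpposite.opLinearEquiv ℂ).toLinearMap ∘ₗ inl S T)
    ((MulOpposite.opLinearEquiv ℂ).toLinearMap ∘ₗ inr S T)
    (fun x x' => by simp [← MulOpposite.op_mul]) (fun z z' => by simp [← MulOpposite.op_mul])

/-- The reversal of words `x₁ ⊗ ⋯ ⊗ xₙ ↦ xₙ ⊗ ⋯ ⊗ x₁`, as a linear map. -/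
def revLin : RedFree S T →ₗ[ℂ] RedFree S T :=
  (MulOpposite.opLinearEquiv ℂ).symm.toLinearMap ∘ₗ (revHom S T).toLinearMap

theorem revLin_mul (a b : RedFree S T) : revLin S T (a * b) = revLin S T b * revLin S T a := by
  simp [revLin]

@[simp] theorem revLin_one : revLin S T 1 = 1 := by simp [revLin]

@[simp] theorem revLin_inl (x : S.Kernel) : revLin S T (inl S T x) = inl S T x := by
  simp [revLin, revHom]

@[simp] theorem revLin_inr (z : T.Kernel) : revLin S T (inr S T z) = inr S T z := by
  simp [revLin, revHom]

theorem revLin_revLin (a : RedFree S T) : revLin S T (revLin S T a) = a := by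
  induction a using word_induction with
  | one => simp
  | add a b ha hb => simp [ha, hb]
  | smul c a ha => simp [ha]
  | left x a ha => simp [revLin_mul, ha]
  | right z a ha => simp [revLin_mul, ha]

/-- The reversal of words, as a linear isomorphism. -/
def rev : RedFree S T ≃ₗ[ℂ] RedFree S T :=
  LinearEquiv.ofLinearMap (revLin S T) (revLin S T)
    (LinearMap.ext (revLin_revLin S T)) (LinearMap.ext (revLin_revLin S T))

/-- The linear map `X → X * Z` with `ξ ↦ ξ` and `x ↦ x` for `x ∈ X°`. -/
def embed : X →ₗ[ℂ] RedFree S T :=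
  S.state.smulRight (1 : RedFree S T) + inl S T ∘ₗ S.proj

/-- The map `X ⊗ (X * Z) → X * Z` which puts a vector of `X` in front of a word: it maps `ξ ⊗ t` to
`t` and `x ⊗ t` to the concatenation of `x` and `t` for `x ∈ X°`. -/
def glue : X ⊗[ℂ] RedFree S T →ₗ[ℂ] RedFree S T :=
  TensorProduct.lift (LinearMap.mul ℂ (RedFree S T) ∘ₗ embed S T)

@[simp] theorem glue_tmul (x : X) (t : RedFree S T) :
    glue S T (x ⊗ₜ t) = S.state x • t + inl S T (S.proj x) * t := by
  simp [glue, embed]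

/-- The operator `x' ⊗ t ↦ p(x') x ⊗ t` on `X ⊗ (X * Z)`. -/
def consLeft : S.Kernel →ₗ[ℂ] Module.End ℂ (X ⊗[ℂ] RedFree S T) :=
  (LinearMap.rTensorHom (RedFree S T)) ∘ₗ
    (LinearMap.smulRightₗ S.state : X →ₗ[ℂ] X →ₗ[ℂ] X) ∘ₗ (LinearMap.ker S.state).subtype

@[simp] theorem consLeft_tmul (x : S.Kernel) (x' : X) (t : RedFree S T) :
    consLeft S T x (x' ⊗ₜ t) = S.state x' • ((x : X) ⊗ₜ t) := by
  simp [consLeft, TensorProduct.smul_tmul']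

/-- The operator `x' ⊗ t ↦ ξ ⊗ (z ⊗ glue (x' ⊗ t))` on `X ⊗ (X * Z)`. -/
def consRight : T.Kernel →ₗ[ℂ] Module.End ℂ (X ⊗[ℂ] RedFree S T) :=
  (LinearMap.llcomp ℂ _ _ _ (TensorProduct.mk ℂ X (RedFree S T) S.vec)) ∘ₗ
    (LinearMap.lcomp ℂ (RedFree S T) (glue S T)) ∘ₗ LinearMap.mul ℂ (RedFree S T) ∘ₗ inr S T

@[simp] theorem consRight_apply (z : T.Kernel) (y : X ⊗[ℂ] RedFree S T) :
    consRight S T z y = S.vec ⊗ₜ (inr S T z * glue S T y) := by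
  simp [consRight]

theorem consLeft_mul (x x' : S.Kernel) : consLeft S T x * consLeft S T x' = 0 := by
  ext y t
  simp

theorem consRight_mul (z z' : T.Kernel) : consRight S T z * consRight S T z' = 0 := by
  refine LinearMap.ext fun y => ?_
  simp [S.state_vec, ← mul_assoc]

/-- The map `X * Z → X ⊗ (X * Z)` which splits off the first letter if it is in `X°`: it maps
`x ⊗ t` to `x ⊗ t` if `x ∈ X°` and `t` is a word which does not start in `X°`, and it maps `t`
to `ξ ⊗ t` if the word `t` does not start in `X°` (in particular if `t = ξ`). So it is the
canonical isomorphism of `X * Z` with `X ⊗ W ⊆ X ⊗ (X * Z)`, where `W` is the span of the words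
which do not start in `X°`. -/
def split : RedFree S T →ₗ[ℂ] X ⊗[ℂ] RedFree S T :=
  (LinearMap.applyₗ (S.vec ⊗ₜ (1 : RedFree S T))) ∘ₗ
    (lift (consLeft S T) (consRight S T) (consLeft_mul S T) (consRight_mul S T)).toLinearMap

@[simp] theorem split_one : split S T 1 = S.vec ⊗ₜ 1 := by simp [split]

@[simp] theorem split_inl_mul (x : S.Kernel) (a : RedFree S T) :
    split S T (inl S T x * a) = consLeft S T x (split S T a) := by simp [split]

@[simp] theorem split_inr_mul (z : T.Kernel) (a : RedFree S T) :
    split S T (inr S T z * a) = S.vec ⊗ₜ (inr S T z * glue S T (split S T a)) := by simp [split]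

theorem glue_consLeft (x : S.Kernel) (y : X ⊗[ℂ] RedFree S T) :
    glue S T (consLeft S T x y) = inl S T x * glue S T y := by
  induction y using TensorProduct.induction_on with
  | zero => simp
  | tmul x' t => simp [mul_add, ← mul_assoc]
  | add y y' h h' => simp [h, h', mul_add]

theorem glue_split (a : RedFree S T) : glue S T (split S T a) = a := by
  induction a using word_induction with
  | one => simp [S.state_vec]
  | add a b ha hb => simp [ha, hb]
  | smul c a ha => simp [ha]
  | left x a ha => simp [glue_consLeft, ha]
  | right z a ha => simp [S.state_vec, ha]

/-- The tensors `x ⊗ t` where `t` is a combination of words which do not start in `X°`. -/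
def splitRange : Submodule ℂ (X ⊗[ℂ] RedFree S T) :=
  Submodule.span ℂ {y | ∃ (x : X) (t : RedFree S T), split S T t = S.vec ⊗ₜ t ∧ y = x ⊗ₜ t}

theorem split_mem (a : RedFree S T) : split S T a ∈ splitRange S T := by
  induction a using word_induction with
  | one => exact Submodule.subset_span ⟨_, _, split_one S T, split_one S T⟩
  | add a b ha hb => rw [map_add]; exact add_mem ha hb
  | smul c a ha => rw [map_smul]; exact Submodule.smul_mem _ _ ha
  | left x a ha =>
    rw [split_inl_mul]
    refine Submodule.span_induction (p := fun y _ => consLeft S T x y ∈ splitRange S T)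
      ?_ ?_ ?_ ?_ ha
    · rintro _ ⟨x', t, ht, rfl⟩
      rw [consLeft_tmul]
      exact Submodule.smul_mem _ _ (Submodule.subset_span ⟨_, _, ht, rfl⟩)
    · simp
    · intro y y' _ _ h h'
      rw [map_add]; exact add_mem h h'
    · intro c y _ h
      rw [map_smul]; exact Submodule.smul_mem _ _ h
  | right z a ha =>
    refine Submodule.subset_span ⟨S.vec, inr S T z * a, ?_, ?_⟩ <;> simp [glue_split]

theorem split_glue {y : X ⊗[ℂ] RedFree S T} (hy : y ∈ splitRange S T) :
    split S T (glue S T y) = y := by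
  refine Submodule.span_induction (p := fun y _ => split S T (glue S T y) = y) ?_ ?_ ?_ ?_ hy
  · rintro _ ⟨x, t, ht, rfl⟩
    have : x = S.state x • S.vec + S.proj x := by simp [PtSpace.coe_proj]
    rw [glue_tmul, map_add, map_smul, split_inl_mul, ht, consLeft_tmul, S.state_vec, one_smul]
    conv_rhs => rw [this, TensorProduct.add_tmul, ← TensorProduct.smul_tmul']
  · simp
  · intro y y' _ _ h h'
    simp [h, h']
  · intro c y _ h
    simp [h]

theorem rTensor_mem (f : Module.End ℂ X) {y : X ⊗[ℂ] RedFree S T} (hy : y ∈ splitRange S T) :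
    LinearMap.rTensor (RedFree S T) f y ∈ splitRange S T := by
  refine Submodule.span_induction
    (p := fun y _ => LinearMap.rTensor (RedFree S T) f y ∈ splitRange S T) ?_ ?_ ?_ ?_ hy
  · rintro _ ⟨x, t, ht, rfl⟩
    exact Submodule.subset_span ⟨f x, t, ht, by simp⟩
  · simp
  · intro y y' _ _ h h'
    rw [map_add]; exact add_mem h h'
  · intro c y _ h
    rw [map_smul]; exact Submodule.smul_mem _ _ h

/-- The left action of the operators on `X` on the free product `X * Z`: an operator acts on the
first letter of a word, where a word which does not start in `X°` is read as `ξ ⊗` word. -/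
def leftRep : Module.End ℂ X →ₐ[ℂ] Module.End ℂ (RedFree S T) :=
  AlgHom.ofLinearMap
    (LinearMap.llcomp ℂ _ _ _ (glue S T) ∘ₗ LinearMap.lcomp ℂ _ (split S T) ∘ₗ
      LinearMap.rTensorHom (RedFree S T))
    (by refine LinearMap.ext fun a => ?_
        simp [Module.End.one_eq_id, glue_split])
    (by intro f g
        refine LinearMap.ext fun a => ?_
        simp [Module.End.mul_eq_comp, LinearMap.rTensor_comp,
          split_glue S T (rTensor_mem S T g (split_mem S T a))])

/-- The left action of the operators on `Z` on the free product `X * Z`. -/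
def leftRep' : Module.End ℂ Z →ₐ[ℂ] Module.End ℂ (RedFree S T) :=
  ((swap T S).conjAlgEquiv ℂ).toAlgHom.comp (leftRep T S)

/-- The right action of the operators on `X` on the free product `X * Z`: an operator acts on the
last letter of a word, where a word which does not end in `X°` is read as word `⊗ ξ`. -/
def rightRep : Module.End ℂ X →ₐ[ℂ] Module.End ℂ (RedFree S T) :=
  ((rev S T).conjAlgEquiv ℂ).toAlgHom.comp (leftRep S T)

/-- The right action of the operators on `Z` on the free product `X * Z`. -/
def rightRep' : Module.End ℂ Z →ₐ[ℂ] Module.End ℂ (RedFree S T) :=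
  ((rev S T).conjAlgEquiv ℂ).toAlgHom.comp (leftRep' S T)

/-- The specified functional on `X * Z`: it is `1` at `ξ` and vanishes on all words of positive
length. -/
def vacuum : RedFree S T →ₗ[ℂ] ℂ :=
  (lift (0 : S.Kernel →ₗ[ℂ] ℂ) (0 : T.Kernel →ₗ[ℂ] ℂ) (by simp) (by simp)).toLinearMap

/-- An auxiliary representation by `3 × 3` matrices. The basis vectors `0`, `1`, `2` stand for the
empty word, words starting in `X°` and words starting in `Z°`. -/
def wordRep (q : X →ₗ[ℂ] ℂ) (r : Z →ₗ[ℂ] ℂ) : RedFree S T →ₐ[ℂ] Matrix (Fin 3) (Fin 3) ℂ :=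
  lift ((q ∘ₗ (LinearMap.ker S.state).subtype).smulRight !![0, 0, 0; 1, 0, 1; 0, 0, 0])
    ((r ∘ₗ (LinearMap.ker T.state).subtype).smulRight !![0, 0, 0; 0, 0, 0; 1, 1, 0])
    (fun x x' => by ext i j; fin_cases i <;> fin_cases j <;> simp)
    (fun z z' => by ext i j; fin_cases i <;> fin_cases j <;> simp)

/-- The second functional on `X * Z` which is induced by functionals `q` on `X` and `r` on `Z`:
it is `1` at `ξ` and its value at an alternating word is the product of the values of `q` and `r` at
the letters. -/
def wordFunctional (q : X →ₗ[ℂ] ℂ) (r : Z →ₗ[ℂ] ℂ) : RedFree S T →ₗ[ℂ] ℂ where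
  toFun a := ∑ i, wordRep S T q r a i 0
  map_add' a b := by simp [Finset.sum_add_distrib]
  map_smul' c a := by simp [Finset.mul_sum]

end RedFree

end RedFree

/-! ## The conditionally bi-free product -/

/-- A unital linear functional on a unital complex algebra. -/
structure UnitalFunctional (B : Type u) [Ring B] [Algebra ℂ B] where
  toLin : B →ₗ[ℂ] ℂ
  map_one : toLin 1 = 1

namespace UnitalFunctional

variable {B : Type u} [Ring B] [Algebra ℂ B] {C : Type v} [Ring C] [Algebra ℂ C]

/-- `B = ℂ 1 ⊕ ker ψ` as a vector space with specified vector `1`. -/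
def toPtSpace (ψ : UnitalFunctional B) : PtSpace B := ⟨1, ψ.toLin, ψ.map_one⟩

/-- The composition of a unital functional with a unital homomorphism. -/
def comp (ψ : UnitalFunctional C) (f : B →ₐ[ℂ] C) : UnitalFunctional B :=
  ⟨ψ.toLin ∘ₗ f.toLinearMap, by simp [ψ.map_one]⟩

end UnitalFunctional

section CBiFree

variable {L₁ : Type u} {R₁ : Type v} {L₂ : Type u'} {R₂ : Type v'}
  [Ring L₁] [Algebra ℂ L₁] [Ring R₁] [Algebra ℂ R₁]
  [Ring L₂] [Algebra ℂ L₂] [Ring R₂] [Algebra ℂ R₂]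

/-- The action of `(L₁ * R₁) * (L₂ * R₂)` on the free product of the spaces
`Xₖ = Lₖ * Rₖ = ℂ 1 ⊕ ker ψₖ`: an element of `Lₖ` acts through the left action, and an element of
`Rₖ` through the right action, of its left multiplication operator on `Xₖ`. -/
def biFreeRep (ψ₁ : UnitalFunctional (FreeProd L₁ R₁)) (ψ₂ : UnitalFunctional (FreeProd L₂ R₂)) :
    FreeProd (FreeProd L₁ R₁) (FreeProd L₂ R₂) →ₐ[ℂ]
      Module.End ℂ (RedFree ψ₁.toPtSpace ψ₂.toPtSpace) :=
  FreeProd.lift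
    (FreeProd.lift
      ((RedFree.leftRep ψ₁.toPtSpace ψ₂.toPtSpace).comp ((Algebra.lmul ℂ _).comp FreeProd.inl))
      ((RedFree.rightRep ψ₁.toPtSpace ψ₂.toPtSpace).comp ((Algebra.lmul ℂ _).comp FreeProd.inr)))
    (FreeProd.lift
      ((RedFree.leftRep' ψ₁.toPtSpace ψ₂.toPtSpace).comp ((Algebra.lmul ℂ _).comp FreeProd.inl))
      ((RedFree.rightRep' ψ₁.toPtSpace ψ₂.toPtSpace).comp ((Algebra.lmul ℂ _).comp FreeProd.inr)))

/-- The conditionally bi-free product `(φ, ψ) = (φ₁, ψ₁) ** (φ₂, ψ₂)` of pairs of unital functionals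
on `L₁ * R₁` and `L₂ * R₂`. The second coordinate `ψ` is the bi-free product of `ψ₁` and `ψ₂`. -/
def cBiFreeProduct (p₁ : UnitalFunctional (FreeProd L₁ R₁) × UnitalFunctional (FreeProd L₁ R₁))
    (p₂ : UnitalFunctional (FreeProd L₂ R₂) × UnitalFunctional (FreeProd L₂ R₂)) :
    UnitalFunctional (FreeProd (FreeProd L₁ R₁) (FreeProd L₂ R₂)) ×
      UnitalFunctional (FreeProd (FreeProd L₁ R₁) (FreeProd L₂ R₂)) :=
  (⟨RedFree.wordFunctional _ _ p₁.1.toLin p₂.1.toLin ∘ₗ LinearMap.applyₗ 1 ∘ₗ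
      (biFreeRep p₁.2 p₂.2).toLinearMap, by simp [RedFree.wordFunctional, Matrix.one_apply]⟩,
    ⟨RedFree.vacuum _ _ ∘ₗ LinearMap.applyₗ 1 ∘ₗ (biFreeRep p₁.2 p₂.2).toLinearMap, by
      simp [RedFree.vacuum]⟩)

end CBiFree

/-! ## The bi-monotonic product -/

section BiMonotonic

variable {L₁ : Type u} {R₁ : Type v} {L₂ : Type u'} {R₂ : Type v'}
  [NonUnitalRing L₁] [Module ℂ L₁] [IsScalarTower ℂ L₁ L₁] [SMulCommClass ℂ L₁ L₁]
  [NonUnitalRing R₁] [Module ℂ R₁] [IsScalarTower ℂ R₁ R₁] [SMulCommClass ℂ R₁ R₁]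
  [NonUnitalRing L₂] [Module ℂ L₂] [IsScalarTower ℂ L₂ L₂] [SMulCommClass ℂ L₂ L₂]
  [NonUnitalRing R₂] [Module ℂ R₂] [IsScalarTower ℂ R₂ R₂] [SMulCommClass ℂ R₂ R₂]

/-- The canonical identification of the free product of the unitizations of `L` and `R` with the
unitization of `L ⊔ R`. -/
def toUnitization (L : Type u) (R : Type v)
    [NonUnitalRing L] [Module ℂ L] [IsScalarTower ℂ L L] [SMulCommClass ℂ L L]
    [NonUnitalRing R] [Module ℂ R] [IsScalarTower ℂ R R] [SMulCommClass ℂ R R] :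
    FreeProd (Unitization ℂ L) (Unitization ℂ R) →ₐ[ℂ] Unitization ℂ (NUFreeProd L R) :=
  NUFreeProd.unitalLift NUFreeProd.inl NUFreeProd.inr

/-- The unital extension `λ 1 + a ↦ λ + φ(a)` of a linear functional to the unitization. -/
def unitalExtension {A : Type u} [NonUnitalRing A] [Module ℂ A] [IsScalarTower ℂ A A]
    [SMulCommClass ℂ A A] (φ : A →ₗ[ℂ] ℂ) : UnitalFunctional (Unitization ℂ A) :=
  ⟨(Unitization.fstHom ℂ A).toLinearMap + φ ∘ₗ Unitization.sndHom ℂ ℂ A, by simp⟩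

/-- The functional `φ̃` on the free product of the unitizations of `L` and `R`. -/
def tildeFunctional (φ : NUFreeProd L₁ R₁ →ₗ[ℂ] ℂ) :
    UnitalFunctional (FreeProd (Unitization ℂ L₁) (Unitization ℂ R₁)) :=
  (unitalExtension φ).comp (toUnitization L₁ R₁)

/-- The delta functional `λ 1 + a ↦ λ` on the free product of the unitizations of `L` and `R`. -/
def deltaFunctional (L : Type u) (R : Type v)
    [NonUnitalRing L] [Module ℂ L] [IsScalarTower ℂ L L] [SMulCommClass ℂ L L]
    [NonUnitalRing R] [Module ℂ R] [IsScalarTower ℂ R R] [SMulCommClass ℂ R R] :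
    UnitalFunctional (FreeProd (Unitization ℂ L) (Unitization ℂ R)) :=
  UnitalFunctional.comp ⟨(Unitization.fstHom ℂ (NUFreeProd L R)).toLinearMap, by simp⟩
    (toUnitization L R)

/-- The canonical embedding of `(L₁ ⊔ R₁) ⊔ (L₂ ⊔ R₂)` into the unital free product of the
unitizations of the four algebras. -/
def embedUnital (L₁ : Type u) (R₁ : Type v) (L₂ : Type u') (R₂ : Type v')
    [NonUnitalRing L₁] [Module ℂ L₁] [IsScalarTower ℂ L₁ L₁] [SMulCommClass ℂ L₁ L₁]
    [NonUnitalRing R₁] [Module ℂ R₁] [IsScalarTower ℂ R₁ R₁] [SMulCommClass ℂ R₁ R₁]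
    [NonUnitalRing L₂] [Module ℂ L₂] [IsScalarTower ℂ L₂ L₂] [SMulCommClass ℂ L₂ L₂]
    [NonUnitalRing R₂] [Module ℂ R₂] [IsScalarTower ℂ R₂ R₂] [SMulCommClass ℂ R₂ R₂] :
    NUFreeProd (NUFreeProd L₁ R₁) (NUFreeProd L₂ R₂) →ₙₐ[ℂ]
      FreeProd (FreeProd (Unitization ℂ L₁) (Unitization ℂ R₁))
        (FreeProd (Unitization ℂ L₂) (Unitization ℂ R₂)) :=
  NUFreeProd.lift (FreeProd.inl.toNonUnitalAlgHom.comp (NUFreeProd.incl L₁ R₁))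
    (FreeProd.inr.toNonUnitalAlgHom.comp (NUFreeProd.incl L₂ R₂))

/-- The (type I) bi-monotonic product of `φ₁` and `φ₂`, as a functional on
`(L₁ ⊔ R₁) ⊔ (L₂ ⊔ R₂)`: the restriction of the first coordinate of the conditionally bi-free
product `(φ̃₁, δ₁) ** (φ̃₂, φ̃₂)`. -/
def biMonotonicProduct (φ₁ : NUFreeProd L₁ R₁ →ₗ[ℂ] ℂ) (φ₂ : NUFreeProd L₂ R₂ →ₗ[ℂ] ℂ) :
    NUFreeProd (NUFreeProd L₁ R₁) (NUFreeProd L₂ R₂) →ₗ[ℂ] ℂ :=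
  (cBiFreeProduct (tildeFunctional φ₁, deltaFunctional L₁ R₁)
      (tildeFunctional φ₂, tildeFunctional φ₂)).1.toLin ∘ₗ
    (embedUnital L₁ R₁ L₂ R₂ : _ →ₗ[ℂ] _)

/-- The bi-monotonic product of `φ₁` and `φ₂`, as a functional on the pair of algebras
`(L₁ ⊔ L₂, R₁ ⊔ R₂)`, that is, on `(L₁ ⊔ L₂) ⊔ (R₁ ⊔ R₂) ≃ (L₁ ⊔ R₁) ⊔ (L₂ ⊔ R₂)`. -/
def pairProduct (φ₁ : NUFreeProd L₁ R₁ →ₗ[ℂ] ℂ) (φ₂ : NUFreeProd L₂ R₂ →ₗ[ℂ] ℂ) :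
    NUFreeProd (NUFreeProd L₁ L₂) (NUFreeProd R₁ R₂) →ₗ[ℂ] ℂ :=
  biMonotonicProduct φ₁ φ₂ ∘ₗ (NUFreeProd.regroup L₁ L₂ R₁ R₂ : _ →ₗ[ℂ] _)

end BiMonotonic

end BiMono

end

/-!
Both sides are computed on words in the generators by the same combinatorial recursion.

In the product `(φ̃₁, δ₁) ** (φ̃₂, φ̃₂)`, a letter of `A₁` maps `X₁` into `X₁° = ker δ₁`, so a word
which contains `x ⊗ z ⊗ x'` with `x, x' ∈ X₁°` and `z ∈ X₂°` keeps such a part whatever acts on it.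
Since moreover the functional on the free product vanishes on every word with a letter in
`X₂° = ker φ̃₂`, the span `RedFree.locked` of these words may be divided out. What remains of the orbit
of `ξ` are the vectors `y ∈ X₂` and `y ⊗ x ⊗ y'` with `x ∈ X₁°` and `y, y' ∈ X₂`. On these, left and
right letters of `A₂` multiply `y` and `y'`, and a left letter `a` of `A₁` maps `y` to `1 ⊗ a ⊗ y` and
`y ⊗ x ⊗ y'` to `φ̃₂(y) 1 ⊗ a x ⊗ y'`; right letters act symmetrically. The value of the functional is
`φ̃₂(y)` and `φ̃₂(y) φ̃₁(x) φ̃₂(y')`. Hence the moments of the product are determined by the moments of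
the factors through a recursion on words (`Phase.moment`, `moments_pairProduct`): list the left
letters in their order and then the right letters in reverse order; the letters of `A₁` contribute one
moment of `φ₁`, and each interval of letters of `A₂` between them contributes one moment of `φ₂`.

In this form associativity is a statement about words (`Phase.moment_assoc`), proved by following
the states of the two iterated recursions in parallel (`Phase.Corr`). Finally, functionals which agree
on all words in a generating set of letters are equal (`ext_of_moments`).
-/

noncomputable section

namespace BiMono

/-! ### The moment recursion -/

/-- The state reached after the letters of a word in `α ⊕ β` have been applied, from the last one to
the first one, to the specified vector. Before a letter of `α` occurs, this is a word `l` in `β`.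
Afterwards it is a multiple `c` of `u ⊗ x ⊗ v`: the letters of `α` form the word `x`, the words `u`
and `v` in `β` are those on which the next left and right letters of `β` act, and `c` collects the
moments of the words in `β` which are enclosed by letters of `α`. -/
inductive Phase (α β : Type*) where
  | initial (l : List β) : Phase α β
  | mixed (c : ℂ) (u : List β) (x : List α) (v : List β) : Phase α β

namespace Phase

variable {α β γ α' β' : Type*} (s : α → Bool) (t : β → Bool) (r : γ → Bool)
  (m₁ : List α → ℂ) (m₂ : List β → ℂ) (m₃ : List γ → ℂ)

/-- The effect of a letter on a state. The functions `s` and `t` tell the left letters (`true`) from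
the right letters (`false`), and `m₂` gives the moments of the words in `β`. -/
def step : α ⊕ β → Phase α β → Phase α β
  | .inl a, .initial l => bif s a then .mixed 1 [] [a] l else .mixed 1 l [a] []
  | .inl a, .mixed c u x v =>
    bif s a then .mixed (c * m₂ u) [] (a :: x) v else .mixed (c * m₂ v) u (a :: x) []
  | .inr b, .initial l => .initial (b :: l)
  | .inr b, .mixed c u x v => bif t b then .mixed c (b :: u) x v else .mixed c u x (b :: v)

/-- The state reached by a word. -/
def run (w : List (α ⊕ β)) : Phase α β := w.foldr (step s t m₂) (.initial [])

@[simp] theorem run_nil : run s t m₂ [] = .initial [] := rfl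

@[simp] theorem run_cons (a : α ⊕ β) (w : List (α ⊕ β)) :
    run s t m₂ (a :: w) = step s t m₂ a (run s t m₂ w) := rfl

/-- The value of a state, given the moments of the words in `α` and in `β`. -/
def val : Phase α β → ℂ
  | .initial l => m₂ l
  | .mixed c u x v => c * m₂ u * m₁ x * m₂ v

/-- The moments of the words in `α ⊕ β` which are determined by the moments `m₁` of the words in `α`
and the moments `m₂` of the words in `β`. -/
def moment (w : List (α ⊕ β)) : ℂ := val m₁ m₂ (run s t m₂ w)

/-- A renaming of the letters. -/
def map (f : α → α') (g : β → β') : Phase α β → Phase α' β'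
  | .initial l => .initial (l.map g)
  | .mixed c u x v => .mixed c (u.map g) (x.map f) (v.map g)

theorem run_map (s : α' → Bool) (t : β' → Bool) (m₂ : List β' → ℂ) (f : α → α') (g : β → β')
    (w : List (α ⊕ β)) :
    run s t m₂ (w.map (Sum.map f g)) =
      map f g (run (s ∘ f) (t ∘ g) (m₂ ∘ List.map g) w) := by
  induction w with
  | nil => rfl
  | cons a w ih =>
    rw [List.map_cons, run_cons, run_cons, ih]
    rcases a with a | b
    · rcases run (s ∘ f) (t ∘ g) (m₂ ∘ List.map g) w with l | ⟨c, u, x, v⟩ <;>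
        cases h : s (f a) <;> simp [step, map, h]
    · rcases run (s ∘ f) (t ∘ g) (m₂ ∘ List.map g) w with l | ⟨c, u, x, v⟩ <;>
        cases h : t (g b) <;> simp [step, map, h]

theorem moment_map (s : α' → Bool) (t : β' → Bool) (m₁ : List α' → ℂ) (m₂ : List β' → ℂ)
    (f : α → α') (g : β → β') (w : List (α ⊕ β)) :
    moment s t m₁ m₂ (w.map (Sum.map f g)) =
      moment (s ∘ f) (t ∘ g) (m₁ ∘ List.map f) (m₂ ∘ List.map g) w := by
  rw [moment, moment, run_map]
  cases run (s ∘ f) (t ∘ g) (m₂ ∘ List.map g) w <;> simp [val, map]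

theorem run_mixed_ne_nil {w : List (α ⊕ β)} {c : ℂ} {u : List β} {x : List α} {v : List β}
    (h : run s t m₂ w = .mixed c u x v) : x ≠ [] := by
  induction w generalizing c u x v with
  | nil => cases h
  | cons a w ih =>
    rw [run_cons] at h
    rcases a with a | b
    · rcases h' : run s t m₂ w with l | ⟨c', u', x', v'⟩ <;>
        cases h'' : s a <;> simp [step, h', h''] at h <;> simp [← h]
    · rcases h' : run s t m₂ w with l | ⟨c', u', x', v'⟩
      · simp [step, h'] at h
      · have := ih h'
        cases h'' : t b <;> simp [step, h', h''] at h <;> simpa [← h]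

/-- What the left letters still see of a state of a word in `β ⊕ γ`, when no right letter can act on
it any more: a scalar, a word in `γ` and a word in `β`. -/
def leftView : Phase β γ → ℂ × List γ × List β
  | .initial l => (1, l, [])
  | .mixed c u x v => (c * m₃ v, u, x)

/-- What the right letters still see of a state of a word in `β ⊕ γ`, when no left letter can act on
it any more. -/
def rightView : Phase β γ → ℂ × List γ × List β
  | .initial l => (1, l, [])
  | .mixed c u x v => (c * m₃ u, v, x)

/-- The correspondence between the states of a word in `α`, `β` and `γ` for the two ways of
bracketing. The three cases are: no letter of `α` or `β` has occurred, a letter of `β` but none of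
`α` has occurred, a letter of `α` has occurred. In the last case, the words `U` and `V` in `β ⊕ γ` on
the two sides of the letters of `α` are only acted upon by left and by right letters, respectively,
so that only their views matter. -/
inductive Corr : Phase (α ⊕ β) γ → Phase α (β ⊕ γ) → Prop
  | initial {l l' : List _} (h : run t r m₃ l = .initial l') :
      Corr (.initial l') (.initial l)
  | mixed {l c u x x' v} (h : run t r m₃ l = .mixed c u x v) (h' : run s t m₂ x' = .initial x) :
      Corr (.mixed c u x' v) (.initial l)
  | full {c u x' v c' u' x v' C U V d e} (h : run s t m₂ x' = .mixed c' u' x v')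
      (hU : leftView m₃ (run t r m₃ U) = (d, u, u')) (hV : rightView m₃ (run t r m₃ V) = (e, v, v'))
      (hc : c * c' = C * d * e) : Corr (.mixed c u x' v) (.mixed C U x V)

theorem leftView_step_inr {g : γ} (hg : r g = true) {p : Phase β γ} {d u u'}
    (h : leftView m₃ p = (d, u, u')) :
    leftView m₃ (step t r m₃ (.inr g) p) = (d, g :: u, u') := by
  cases p <;> simp_all [step, leftView]

theorem leftView_step_inl {b : β} (hb : t b = true) {p : Phase β γ} {d u u'}
    (h : leftView m₃ p = (d, u, u')) :
    leftView m₃ (step t r m₃ (.inl b) p) = (d * m₃ u, [], b :: u') := by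
  cases p <;> simp [leftView] at h <;> obtain ⟨rfl, rfl, rfl⟩ := h <;> simp [step, leftView, hb]
  ring

theorem rightView_step_inr {g : γ} (hg : r g = false) {p : Phase β γ} {d u u'}
    (h : rightView m₃ p = (d, u, u')) :
    rightView m₃ (step t r m₃ (.inr g) p) = (d, g :: u, u') := by
  cases p <;> simp_all [step, rightView]

theorem rightView_step_inl {b : β} (hb : t b = false) {p : Phase β γ} {d u u'}
    (h : rightView m₃ p = (d, u, u')) :
    rightView m₃ (step t r m₃ (.inl b) p) = (d * m₃ u, [], b :: u') := by
  cases p <;> simp [rightView] at h <;> obtain ⟨rfl, rfl, rfl⟩ := h <;> simp [step, rightView, hb]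
  ring

theorem val_eq_of_leftView (h₂ : m₂ [] = 1) {p : Phase β γ} {d u u'}
    (h : leftView m₃ p = (d, u, u')) : val m₂ m₃ p = d * m₃ u * m₂ u' := by
  cases p <;> simp [leftView] at h <;> obtain ⟨rfl, rfl, rfl⟩ := h <;> simp [val, h₂]
  ring

theorem val_eq_of_rightView (h₂ : m₂ [] = 1) {p : Phase β γ} {d u u'}
    (h : rightView m₃ p = (d, u, u')) : val m₂ m₃ p = d * m₃ u * m₂ u' := by
  cases p <;> simp [rightView] at h <;> obtain ⟨rfl, rfl, rfl⟩ := h <;> simp [val, h₂]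
  ring

theorem corr_step (h₂ : m₂ [] = 1) (a : (α ⊕ β) ⊕ γ)
    {p : Phase (α ⊕ β) γ} {q : Phase α (β ⊕ γ)} (h : Corr s t r m₂ m₃ p q) :
    Corr s t r m₂ m₃ (step (Sum.elim s t) r m₃ a p)
      (step s (Sum.elim t r) (moment t r m₂ m₃) (Equiv.sumAssoc α β γ a) q) := by
  cases h with
  | @initial l l' h =>
    rcases a with (a | b) | g
    · cases hs : s a <;> simp only [step, Equiv.sumAssoc_apply_inl_inl, Sum.elim_inl, hs, cond]
      · exact .full (d := 1) (e := 1) (c' := 1) (by simp [step, hs]; rfl) (by simp [h, leftView])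
          rfl (by simp)
      · exact .full (d := 1) (e := 1) (c' := 1) (by simp [step, hs]; rfl) rfl
          (by simp [h, rightView]) (by simp)
    · cases ht : t b <;>
        simp only [step, Equiv.sumAssoc_apply_inl_inr, Sum.elim_inr, ht, cond] <;>
        exact .mixed (x := [b]) (by simp [h, step, ht]) (by simp [step])
    · exact .initial (by simp [h, step])
  | @mixed l c u x x' v h h' =>
    rcases a with (a | b) | g
    · cases hs : s a <;> simp only [step, Equiv.sumAssoc_apply_inl_inl, Sum.elim_inl, hs, cond]
      · exact .full (c' := 1) (by simp [h', step, hs]; rfl) (by rw [h]; rfl) rfl (by simp)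
      · exact .full (c' := 1) (by simp [h', step, hs]; rfl) rfl (by rw [h]; rfl) (by simp)
    · cases ht : t b <;>
        simp only [step, Equiv.sumAssoc_apply_inl_inr, Sum.elim_inr, ht, cond] <;>
        exact .mixed (x := b :: x) (by simp [h, step, ht]) (by simp [h', step])
    · cases hr : r g <;> simp only [step, Equiv.sumAssoc_apply_inr, hr, cond] <;>
        exact .mixed (by simp [h, step, hr]) h'
  | @full c u x' v c' u' x v' C U V d e h hU hV hc =>
    rcases a with (a | b) | g
    · cases hs : s a <;> simp only [step, Equiv.sumAssoc_apply_inl_inl, Sum.elim_inl, hs, cond]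
      · refine .full (by simp [h, step, hs]; rfl) hU rfl ?_
        rw [moment, val_eq_of_rightView m₂ m₃ h₂ hV]
        linear_combination (m₃ v * m₂ v') * hc
      · refine .full (by simp [h, step, hs]; rfl) rfl hV ?_
        rw [moment, val_eq_of_leftView m₂ m₃ h₂ hU]
        linear_combination (m₃ u * m₂ u') * hc
    · cases ht : t b <;>
        simp only [step, Equiv.sumAssoc_apply_inl_inr, Sum.elim_inl, Sum.elim_inr, ht, cond]
      · exact .full (by simp [h, step, ht]; rfl) hU
          (rightView_step_inl t r m₃ ht hV) (by linear_combination m₃ v * hc)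
      · exact .full (by simp [h, step, ht]; rfl)
          (leftView_step_inl t r m₃ ht hU) hV (by linear_combination m₃ u * hc)
    · cases hr : r g <;> simp only [step, Equiv.sumAssoc_apply_inr, Sum.elim_inr, hr, cond]
      · exact .full h hU (rightView_step_inr t r m₃ hr hV) hc
      · exact .full h (leftView_step_inr t r m₃ hr hU) hV hc

theorem corr_run (h₂ : m₂ [] = 1) (w : List ((α ⊕ β) ⊕ γ)) :
    Corr s t r m₂ m₃ (run (Sum.elim s t) r m₃ w)
      (run s (Sum.elim t r) (moment t r m₂ m₃) (w.map (Equiv.sumAssoc α β γ))) := by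
  induction w with
  | nil => exact .initial rfl
  | cons a w ih => exact corr_step s t r m₂ m₃ h₂ a ih

/-- Associativity of the product of moments. -/
theorem moment_assoc (h₂ : m₂ [] = 1) (w : List ((α ⊕ β) ⊕ γ)) :
    moment (Sum.elim s t) r (moment s t m₁ m₂) m₃ w =
      moment s (Sum.elim t r) m₁ (moment t r m₂ m₃) (w.map (Equiv.sumAssoc α β γ)) := by
  have := corr_run s t r m₂ m₃ h₂ w
  rw [moment, moment]
  generalize run (Sum.elim s t) r m₃ w = p at this ⊢
  generalize run s (Sum.elim t r) (moment t r m₂ m₃) _ = q at this ⊢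
  cases this with
  | initial h => simp [val, moment, h]
  | mixed h h' => simp [val, moment, h, h']
  | @full c u x' v c' u' x v' C U V d e h hU hV hc =>
    simp only [val.eq_2, moment, h]
    rw [val_eq_of_leftView m₂ m₃ h₂ hU, val_eq_of_rightView m₂ m₃ h₂ hV]
    linear_combination (m₃ u * m₂ u' * m₁ x * m₂ v' * m₃ v) * hc

end Phase

open scoped TensorProduct

namespace RedFree

universe u v
variable {X : Type u} [AddCommGroup X] [Module ℂ X] {Z : Type v} [AddCommGroup Z] [Module ℂ Z]
variable (S : PtSpace X) (T : PtSpace Z)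

/-! ### The left and right actions on words -/

theorem leftRep_apply (f : Module.End ℂ X) (a : RedFree S T) :
    leftRep S T f a = glue S T (LinearMap.rTensor _ f (split S T a)) := rfl

theorem embed_apply (x : X) : embed S T x = S.state x • 1 + inl S T (S.proj x) := rfl

@[simp] theorem embed_vec : embed S T S.vec = 1 := by simp [embed_apply, S.state_vec]

theorem glue_tmul' (x : X) (t : RedFree S T) : glue S T (x ⊗ₜ t) = embed S T x * t := by
  simp [embed_apply, add_mul]

theorem split_embed_mul_inr (x : X) (z : T.Kernel) (b : RedFree S T) :
    split S T (embed S T x * (inr S T z * b)) = x ⊗ₜ (inr S T z * b) := by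
  have : x = S.state x • S.vec + S.proj x := by simp [PtSpace.coe_proj]
  rw [embed_apply, add_mul, map_add, split_inl_mul]
  conv_rhs => rw [this, TensorProduct.add_tmul, ← TensorProduct.smul_tmul']
  simp [glue_split, S.state_vec]

theorem split_embed (x : X) : split S T (embed S T x) = x ⊗ₜ 1 := by
  have : x = S.state x • S.vec + S.proj x := by simp [PtSpace.coe_proj]
  rw [embed_apply, map_add, ← mul_one (inl S T (S.proj x)), split_inl_mul]
  conv_rhs => rw [this, TensorProduct.add_tmul, ← TensorProduct.smul_tmul']
  simp [S.state_vec]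

theorem leftRep_embed_mul_inr (f : Module.End ℂ X) (x : X) (z : T.Kernel) (b : RedFree S T) :
    leftRep S T f (embed S T x * (inr S T z * b)) = embed S T (f x) * (inr S T z * b) := by
  simp [leftRep_apply, split_embed_mul_inr, glue_tmul', -glue_tmul]

theorem leftRep_inr_mul (f : Module.End ℂ X) (z : T.Kernel) (b : RedFree S T) :
    leftRep S T f (inr S T z * b) = embed S T (f S.vec) * (inr S T z * b) := by
  simpa using leftRep_embed_mul_inr S T f S.vec z b

theorem leftRep_embed (f : Module.End ℂ X) (x : X) :
    leftRep S T f (embed S T x) = embed S T (f x) := by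
  simp [leftRep_apply, split_embed, glue_tmul', -glue_tmul]

theorem leftRep_one (f : Module.End ℂ X) : leftRep S T f 1 = embed S T (f S.vec) := by
  simpa using leftRep_embed S T f S.vec

/-- The projection `x ↦ p(x) ξ`. Its left action removes the words which start in `X°`. -/
def vecProj : Module.End ℂ X := S.state.smulRight S.vec

theorem leftRep_inl_mul (f : Module.End ℂ X) (x : S.Kernel) (b : RedFree S T) :
    leftRep S T f (inl S T x * b) = embed S T (f x) * leftRep S T (vecProj S) b := by
  rw [leftRep_apply, leftRep_apply, split_inl_mul]
  induction split S T b using TensorProduct.induction_on with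
  | zero => simp
  | tmul x' t => simp [vecProj, glue_tmul', -glue_tmul]
  | add y y' h h' => simp only [map_add, h, h', mul_add]

theorem inl_mul_leftRep_vecProj (x : S.Kernel) (b : RedFree S T) :
    inl S T x * leftRep S T (vecProj S) b = inl S T x * b := by
  conv_rhs => rw [← glue_split S T b]
  rw [leftRep_apply]
  induction split S T b using TensorProduct.induction_on with
  | zero => simp
  | tmul x' t => simp [vecProj, mul_add, ← mul_assoc, S.state_vec]
  | add y y' h h' => simp only [map_add, h, h', mul_add]

/-- If `f x` lies in `X°` for some `x ∈ X°`, then `f` acts on the words starting in `x` by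
replacing this letter. -/
theorem leftRep_inl_mul_of_state (f : Module.End ℂ X) (x : S.Kernel) (h : S.state (f x) = 0)
    (b : RedFree S T) : leftRep S T f (inl S T x * b) = inl S T (S.proj (f x)) * b := by
  rw [leftRep_inl_mul, embed_apply, h, zero_smul, zero_add, inl_mul_leftRep_vecProj]

/-- The left action leaves invariant the part of a left ideal `J` which consists of the words ending
in some given `m ∈ J`, if this holds for `m` itself. -/
theorem leftRep_mul_mem (J : Submodule ℂ (RedFree S T)) (hJ : ∀ a b, b ∈ J → a * b ∈ J)
    {m : RedFree S T} (hm : m ∈ J) (f : Module.End ℂ X) (hf : leftRep S T f m ∈ J)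
    (hv : leftRep S T (vecProj S) m ∈ J) (a : RedFree S T) : leftRep S T f (a * m) ∈ J := by
  have key (a) : leftRep S T (vecProj S) (a * m) ∈ J := by
    induction a using word_induction with
    | one => simpa using hv
    | add a b ha hb => rw [add_mul, map_add]; exact add_mem ha hb
    | smul c a ha => rw [smul_mul_assoc, map_smul]; exact J.smul_mem _ ha
    | left x a ha => rw [mul_assoc, leftRep_inl_mul]; exact hJ _ _ ha
    | right z a ha => rw [mul_assoc, leftRep_inr_mul]; exact hJ _ _ (hJ _ _ (hJ _ _ hm))
  induction a using word_induction with
  | one => simpa using hf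
  | add a b ha hb => rw [add_mul, map_add]; exact add_mem ha hb
  | smul c a ha => rw [smul_mul_assoc, map_smul]; exact J.smul_mem _ ha
  | left x a ha => rw [mul_assoc, leftRep_inl_mul]; exact hJ _ _ (key a)
  | right z a ha => rw [mul_assoc, leftRep_inr_mul]; exact hJ _ _ (hJ _ _ (hJ _ _ hm))

/-! ### Exchange and reversal -/

@[simp] theorem swapHom_inl (x : S.Kernel) : swapHom S T (inl S T x) = inr T S x := by
  simp [swapHom]

@[simp] theorem swapHom_inr (z : T.Kernel) : swapHom S T (inr S T z) = inl T S z := by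
  simp [swapHom]

theorem leftRep'_apply (f : Module.End ℂ Z) (a : RedFree S T) :
    leftRep' S T f a = swapHom T S (leftRep T S f (swapHom S T a)) := rfl

theorem rightRep_apply (f : Module.End ℂ X) (a : RedFree S T) :
    rightRep S T f a = revLin S T (leftRep S T f (revLin S T a)) := rfl

theorem rightRep'_apply (f : Module.End ℂ Z) (a : RedFree S T) :
    rightRep' S T f a = revLin S T (leftRep' S T f (revLin S T a)) := rfl

/-- The linear map `Z → X * Z` with `ξ ↦ ξ` and `z ↦ z` for `z ∈ Z°`. -/
def embed' : Z →ₗ[ℂ] RedFree S T :=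
  T.state.smulRight (1 : RedFree S T) + inr S T ∘ₗ T.proj

theorem embed'_apply (z : Z) : embed' S T z = T.state z • 1 + inr S T (T.proj z) := rfl

@[simp] theorem embed'_vec : embed' S T T.vec = 1 := by simp [embed'_apply, T.state_vec]

@[simp] theorem swapHom_embed' (z : Z) : swapHom S T (embed' S T z) = embed T S z := by
  simp [embed'_apply, embed_apply]

@[simp] theorem swapHom_embed (x : X) : swapHom S T (embed S T x) = embed' T S x := by
  simp [embed'_apply, embed_apply]

@[simp] theorem revLin_embed' (z : Z) : revLin S T (embed' S T z) = embed' S T z := by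
  simp [embed'_apply]

theorem leftRep'_embed' (f : Module.End ℂ Z) (z : Z) :
    leftRep' S T f (embed' S T z) = embed' S T (f z) := by
  simp [leftRep'_apply, leftRep_embed]

theorem leftRep'_embed'_mul_inl (f : Module.End ℂ Z) (z : Z) (x : S.Kernel) (b : RedFree S T) :
    leftRep' S T f (embed' S T z * (inl S T x * b)) = embed' S T (f z) * (inl S T x * b) := by
  simp [leftRep'_apply, leftRep_embed_mul_inr, swapHom_swapHom]

/-! ### Locked letters -/

/-- The span of the words with two letters in `X°` and a letter in `Z°` between them. -/
def locked : Submodule ℂ (RedFree S T) :=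
  Submodule.span ℂ {y | ∃ a x z x' b, y = a * (inl S T x * (inr S T z * (inl S T x' * b)))}

variable {S T}

theorem mul_mem_locked (a x z x' b) :
    a * (inl S T x * (inr S T z * (inl S T x' * b))) ∈ locked S T :=
  Submodule.subset_span ⟨a, x, z, x', b, rfl⟩

theorem mul_left_mem_locked (a b : RedFree S T) (hb : b ∈ locked S T) : a * b ∈ locked S T := by
  induction hb using Submodule.span_induction with
  | mem y hy =>
    obtain ⟨a', x, z, x', b, rfl⟩ := hy
    rw [← mul_assoc]
    exact mul_mem_locked _ _ _ _ _
  | zero => simp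
  | add y y' _ _ h h' => rw [mul_add]; exact add_mem h h'
  | smul c y _ h => rw [mul_smul_comm]; exact Submodule.smul_mem _ _ h

theorem revLin_mem_locked {a : RedFree S T} (ha : a ∈ locked S T) :
    revLin S T a ∈ locked S T := by
  induction ha using Submodule.span_induction with
  | mem y hy =>
    obtain ⟨a', x, z, x', b, rfl⟩ := hy
    simp only [revLin_mul, revLin_inl, revLin_inr, mul_assoc]
    exact mul_mem_locked _ _ _ _ _
  | zero => simp
  | add y y' _ _ h h' => rw [map_add]; exact add_mem h h'
  | smul c y _ h => rw [map_smul]; exact Submodule.smul_mem _ _ h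

theorem leftRep_mem_locked {f : Module.End ℂ X} (hf : ∀ x : S.Kernel, S.state (f x) = 0)
    {a : RedFree S T} (ha : a ∈ locked S T) : leftRep S T f a ∈ locked S T := by
  induction ha using Submodule.span_induction with
  | mem y hy =>
    obtain ⟨a', x, z, x', b, rfl⟩ := hy
    have h (f : Module.End ℂ X) (hf : S.state (f x) = 0) :
        leftRep S T f (inl S T x * (inr S T z * (inl S T x' * b))) ∈ locked S T := by
      rw [leftRep_inl_mul_of_state _ _ _ _ hf, ← one_mul (inl S T _ * _)]
      exact mul_mem_locked _ _ _ _ _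
    refine leftRep_mul_mem S T _ mul_left_mem_locked ?_ f (h f (hf x)) (h _ ?_) a'
    · rw [← one_mul (inl S T x * _)]
      exact mul_mem_locked _ _ _ _ _
    · simp [vecProj]
  | zero => simp
  | add y y' _ _ h h' => rw [map_add]; exact add_mem h h'
  | smul c y _ h => rw [map_smul]; exact Submodule.smul_mem _ _ h

theorem leftRep'_mem_locked (f : Module.End ℂ Z)
    {a : RedFree S T} (ha : a ∈ locked S T) : leftRep' S T f a ∈ locked S T := by
  induction ha using Submodule.span_induction with
  | mem y hy =>
    obtain ⟨a', x, z, x', b, rfl⟩ := hy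
    set J : Submodule ℂ (RedFree T S) := (locked S T).comap (swapHom T S).toLinearMap
    have hJ (a b) (hb : b ∈ J) : a * b ∈ J := by
      simpa [J] using mul_left_mem_locked (swapHom T S a) _ hb
    have hm : inr T S x * (inl T S z * (inr T S x' * swapHom S T b)) ∈ J := by
      simpa [J, swapHom_swapHom] using mul_mem_locked 1 x z x' b
    have h (f : Module.End ℂ Z) :
        leftRep T S f (inr T S x * (inl T S z * (inr T S x' * swapHom S T b))) ∈ J := by
      rw [leftRep_inr_mul]
      exact hJ _ _ hm
    have := leftRep_mul_mem T S J hJ hm f (h _) (h _) (swapHom S T a')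
    simpa [leftRep'_apply, J] using this
  | zero => simp
  | add y y' _ _ h h' => rw [map_add]; exact add_mem h h'
  | smul c y _ h => rw [map_smul]; exact Submodule.smul_mem _ _ h

theorem rightRep_mem_locked {f : Module.End ℂ X} (hf : ∀ x : S.Kernel, S.state (f x) = 0)
    {a : RedFree S T} (ha : a ∈ locked S T) : rightRep S T f a ∈ locked S T :=
  revLin_mem_locked (leftRep_mem_locked hf (revLin_mem_locked ha))

theorem rightRep'_mem_locked (f : Module.End ℂ Z)
    {a : RedFree S T} (ha : a ∈ locked S T) : rightRep' S T f a ∈ locked S T :=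
  revLin_mem_locked (leftRep'_mem_locked f (revLin_mem_locked ha))

/-! ### The actions on words with at most one letter in `X°` -/

theorem leftRep_embed' {f : Module.End ℂ X} (hf : S.state (f S.vec) = 0) (z : Z) :
    leftRep S T f (embed' S T z) = inl S T (S.proj (f S.vec)) * embed' S T z := by
  rw [embed'_apply, map_add, map_smul, leftRep_one, ← mul_one (inr S T _), leftRep_inr_mul,
    embed_apply, hf]
  simp [mul_add]

/-- Modulo locked words, an operator on `X` which acts from the left on `z ⊗ x ⊗ b` only sees the
component of `z ∈ Z` along the specified vector. -/
theorem leftRep_embed'_mul_inl {f : Module.End ℂ X} (x : S.Kernel) (hv : S.state (f S.vec) = 0)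
    (hx : S.state (f x) = 0) (z : Z) (b : RedFree S T) :
    leftRep S T f (embed' S T z * (inl S T x * b)) -
      T.state z • (inl S T (S.proj (f x)) * b) ∈ locked S T := by
  rw [embed'_apply, add_mul, map_add, smul_mul_assoc, one_mul, map_smul,
    leftRep_inl_mul_of_state _ _ _ _ hx, add_sub_cancel_left, leftRep_inr_mul, embed_apply, hv,
    zero_smul, zero_add, ← one_mul (inl S T _ * _)]
  exact mul_mem_locked _ _ _ _ _

theorem rightRep_embed' {f : Module.End ℂ X} (hf : S.state (f S.vec) = 0) (z : Z) :
    rightRep S T f (embed' S T z) = embed' S T z * inl S T (S.proj (f S.vec)) := by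
  rw [rightRep_apply, revLin_embed', leftRep_embed' hf, revLin_mul, revLin_embed', revLin_inl]

theorem rightRep_mul_inl_mul_embed' {f : Module.End ℂ X} (x : S.Kernel)
    (hv : S.state (f S.vec) = 0) (hx : S.state (f x) = 0) (z : Z) (b : RedFree S T) :
    rightRep S T f (b * inl S T x * embed' S T z) -
      T.state z • (b * inl S T (S.proj (f x))) ∈ locked S T := by
  have := revLin_mem_locked (leftRep_embed'_mul_inl x hv hx z (revLin S T b))
  simpa [rightRep_apply, revLin_mul, revLin_revLin] using this

theorem rightRep'_embed' (f : Module.End ℂ Z) (z : Z) :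
    rightRep' S T f (embed' S T z) = embed' S T (f z) := by
  simp [rightRep'_apply, leftRep'_embed']

theorem rightRep'_mul_inl_mul_embed' (f : Module.End ℂ Z) (z : Z) (x : S.Kernel)
    (b : RedFree S T) :
    rightRep' S T f (b * inl S T x * embed' S T z) = b * inl S T x * embed' S T (f z) := by
  simp [rightRep'_apply, leftRep'_embed'_mul_inl, revLin_mul, revLin_revLin]

/-! ### The word functional -/

section WordFunctional

variable (q : X →ₗ[ℂ] ℂ)

theorem wordRep_inr (z : T.Kernel) : wordRep S T q T.state (inr S T z) = 0 := by
  simp [wordRep, show T.state z = 0 from z.2]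

theorem wordRep_inl (x : S.Kernel) :
    wordRep S T q T.state (inl S T x) = q x • !![0, 0, 0; 1, 0, 1; 0, 0, 0] := by
  simp only [wordRep, lift_inl]
  rfl

theorem wordRep_embed' (z : Z) :
    wordRep S T q T.state (embed' S T z) = T.state z • 1 := by
  simp [embed'_apply, wordRep_inr]

theorem wordFunctional_apply (r : Z →ₗ[ℂ] ℂ) (a : RedFree S T) :
    wordFunctional S T q r a = ∑ i, wordRep S T q r a i 0 := rfl

theorem wordFunctional_embed' (z : Z) :
    wordFunctional S T q T.state (embed' S T z) = T.state z := by
  simp [wordFunctional_apply, wordRep_embed', Matrix.one_apply]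

theorem wordFunctional_embed'_mul_inl_mul_embed' (z z' : Z) (x : S.Kernel) :
    wordFunctional S T q T.state (embed' S T z * inl S T x * embed' S T z') =
      T.state z * q x * T.state z' := by
  simp [wordFunctional_apply, wordRep_embed', wordRep_inl, Fin.sum_univ_three]
  ring

theorem wordFunctional_locked {a : RedFree S T} (ha : a ∈ locked S T) :
    wordFunctional S T q T.state a = 0 := by
  induction ha using Submodule.span_induction with
  | mem y hy =>
    obtain ⟨a', x, z, x', b, rfl⟩ := hy
    simp [wordFunctional_apply, wordRep_inr]
  | zero => simp
  | add y y' _ _ h h' => rw [map_add, h, h', add_zero]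
  | smul c y _ h => rw [map_smul, h, smul_zero]

end WordFunctional

end RedFree

/-! ### Words in the generators -/

section Letters

variable {L₁ R₁ L₂ R₂ : Type*}
  [NonUnitalRing L₁] [Module ℂ L₁] [IsScalarTower ℂ L₁ L₁] [SMulCommClass ℂ L₁ L₁]
  [NonUnitalRing R₁] [Module ℂ R₁] [IsScalarTower ℂ R₁ R₁] [SMulCommClass ℂ R₁ R₁]
  [NonUnitalRing L₂] [Module ℂ L₂] [IsScalarTower ℂ L₂ L₂] [SMulCommClass ℂ L₂ L₂]
  [NonUnitalRing R₂] [Module ℂ R₂] [IsScalarTower ℂ R₂ R₂] [SMulCommClass ℂ R₂ R₂]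

/-- An element of `L` or `R`, as an element of `L ⊔ R`. -/
def letter : L₁ ⊕ R₁ → NUFreeProd L₁ R₁ := Sum.elim NUFreeProd.inl NUFreeProd.inr

/-- The product of a word in `L` and `R`, in the unitization of `L ⊔ R`. -/
def wordProd (w : List (L₁ ⊕ R₁)) : Unitization ℂ (NUFreeProd L₁ R₁) :=
  (w.map fun a => (letter a : Unitization ℂ (NUFreeProd L₁ R₁))).prod

/-- The moments of a functional on `L ⊔ R`; the moment of the empty word is `1`. -/
def moments (φ : NUFreeProd L₁ R₁ →ₗ[ℂ] ℂ) (w : List (L₁ ⊕ R₁)) : ℂ :=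
  (unitalExtension φ).toLin (wordProd w)

@[simp] theorem moments_nil (φ : NUFreeProd L₁ R₁ →ₗ[ℂ] ℂ) : moments φ [] = 1 :=
  (unitalExtension φ).map_one

/-- An element of `L` or `R`, as an element of the free product of the unitizations. -/
def unitalLetter : L₁ ⊕ R₁ → FreeProd (Unitization ℂ L₁) (Unitization ℂ R₁) :=
  fun a => NUFreeProd.incl L₁ R₁ (letter a)

/-- The product of a word in `L` and `R`, in the free product of the unitizations. -/
def unitalProd (w : List (L₁ ⊕ R₁)) : FreeProd (Unitization ℂ L₁) (Unitization ℂ R₁) :=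
  (w.map unitalLetter).prod

theorem toUnitization_unitalLetter (a : L₁ ⊕ R₁) :
    toUnitization L₁ R₁ (unitalLetter a) = (letter a : Unitization ℂ (NUFreeProd L₁ R₁)) := by
  rcases a with a | a
  · change NUFreeProd.unitalLift _ _ (FreeProd.inl (a : Unitization ℂ L₁)) = _
    simp [NUFreeProd.unitalLift, letter]
  · change NUFreeProd.unitalLift _ _ (FreeProd.inr (a : Unitization ℂ R₁)) = _
    simp [NUFreeProd.unitalLift, letter]

theorem toUnitization_unitalProd (w : List (L₁ ⊕ R₁)) :
    toUnitization L₁ R₁ (unitalProd w) = wordProd w := by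
  simp [unitalProd, wordProd, map_list_prod, Function.comp_def, toUnitization_unitalLetter]

theorem tildeFunctional_unitalProd (φ : NUFreeProd L₁ R₁ →ₗ[ℂ] ℂ) (w : List (L₁ ⊕ R₁)) :
    (tildeFunctional φ).toLin (unitalProd w) = moments φ w :=
  congrArg (unitalExtension φ).toLin (toUnitization_unitalProd w)

theorem deltaFunctional_unitalLetter_mul (a : L₁ ⊕ R₁)
    (y : FreeProd (Unitization ℂ L₁) (Unitization ℂ R₁)) :
    (deltaFunctional L₁ R₁).toLin (unitalLetter a * y) = 0 := by
  change (toUnitization L₁ R₁ (unitalLetter a * y)).fst = 0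
  simp [toUnitization_unitalLetter]

theorem deltaFunctional_unitalProd {w : List (L₁ ⊕ R₁)} (hw : w ≠ []) :
    (deltaFunctional L₁ R₁).toLin (unitalProd w) = 0 := by
  cases w with
  | nil => exact absurd rfl hw
  | cons a w => exact deltaFunctional_unitalLetter_mul a _

/-- A letter of one of the pairs `(L₁, R₁)` and `(L₂, R₂)`, as a letter of `(L₁ ⊔ L₂, R₁ ⊔ R₂)`. -/
def pairLetter : (L₁ ⊕ R₁) ⊕ (L₂ ⊕ R₂) → NUFreeProd L₁ L₂ ⊕ NUFreeProd R₁ R₂ :=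
  Sum.elim (Sum.map NUFreeProd.inl NUFreeProd.inl) (Sum.map NUFreeProd.inr NUFreeProd.inr)

variable (φ₁ : NUFreeProd L₁ R₁ →ₗ[ℂ] ℂ) (φ₂ : NUFreeProd L₂ R₂ →ₗ[ℂ] ℂ)

/-- The action of a letter on the free product of the spaces with specified vectors. -/
def letterAction (a : (L₁ ⊕ R₁) ⊕ (L₂ ⊕ R₂)) :
    Module.End ℂ (RedFree (deltaFunctional L₁ R₁).toPtSpace (tildeFunctional φ₂).toPtSpace) :=
  biFreeRep (deltaFunctional L₁ R₁) (tildeFunctional φ₂)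
    (Sum.elim (fun a => FreeProd.inl (unitalLetter a)) (fun a => FreeProd.inr (unitalLetter a)) a)

theorem letterAction_inl_inl (a : L₁) : letterAction φ₂ (.inl (.inl a) : (L₁ ⊕ R₁) ⊕ (L₂ ⊕ R₂)) =
    RedFree.leftRep _ _ (Algebra.lmul ℂ _ (unitalLetter (.inl a))) := by
  change biFreeRep _ _ (FreeProd.inl (FreeProd.inl (a : Unitization ℂ L₁))) = _
  simp only [biFreeRep, FreeProd.lift_inl]
  rfl

theorem letterAction_inl_inr (a : R₁) : letterAction φ₂ (.inl (.inr a) : (L₁ ⊕ R₁) ⊕ (L₂ ⊕ R₂)) =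
    RedFree.rightRep _ _ (Algebra.lmul ℂ _ (unitalLetter (.inr a))) := by
  change biFreeRep _ _ (FreeProd.inl (FreeProd.inr (a : Unitization ℂ R₁))) = _
  simp only [biFreeRep, FreeProd.lift_inl, FreeProd.lift_inr]
  rfl

theorem letterAction_inr_inl (a : L₂) : letterAction φ₂ (.inr (.inl a) : (L₁ ⊕ R₁) ⊕ (L₂ ⊕ R₂)) =
    RedFree.leftRep' _ _ (Algebra.lmul ℂ _ (unitalLetter (.inl a))) := by
  change biFreeRep _ _ (FreeProd.inr (FreeProd.inl (a : Unitization ℂ L₂))) = _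
  simp only [biFreeRep, FreeProd.lift_inl, FreeProd.lift_inr]
  rfl

theorem letterAction_inr_inr (a : R₂) : letterAction φ₂ (.inr (.inr a) : (L₁ ⊕ R₁) ⊕ (L₂ ⊕ R₂)) =
    RedFree.rightRep' _ _ (Algebra.lmul ℂ _ (unitalLetter (.inr a))) := by
  change biFreeRep _ _ (FreeProd.inr (FreeProd.inr (a : Unitization ℂ R₂))) = _
  simp only [biFreeRep, FreeProd.lift_inr]
  rfl

theorem embedUnital_regroup_letter (a : (L₁ ⊕ R₁) ⊕ (L₂ ⊕ R₂)) :
    embedUnital L₁ R₁ L₂ R₂ (NUFreeProd.regroup L₁ L₂ R₁ R₂ (letter (pairLetter a))) =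
      Sum.elim (fun a => FreeProd.inl (unitalLetter a)) (fun a => FreeProd.inr (unitalLetter a))
        a := by
  rcases a with (a | a) | (a | a) <;>
    simp [pairLetter, letter, NUFreeProd.regroup, embedUnital, unitalLetter] <;>
    rfl

/-- The moments of the product are given by the word functional. -/
theorem moments_pairProduct_eq_wordFunctional (w : List ((L₁ ⊕ R₁) ⊕ (L₂ ⊕ R₂))) :
    moments (pairProduct φ₁ φ₂) (w.map pairLetter) =
      RedFree.wordFunctional _ _ (tildeFunctional φ₁).toLin (tildeFunctional φ₂).toLin
        ((w.map (letterAction φ₂)).prod 1) := by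
  let G := Unitization.lift
    ((embedUnital L₁ R₁ L₂ R₂).comp (NUFreeProd.regroup L₁ L₂ R₁ R₂))
  let Φ := (cBiFreeProduct (tildeFunctional φ₁, deltaFunctional L₁ R₁)
      (tildeFunctional φ₂, tildeFunctional φ₂)).1
  have h : (unitalExtension (pairProduct φ₁ φ₂)).toLin = Φ.toLin ∘ₗ G.toLinearMap := by
    refine LinearMap.ext fun y => ?_
    induction y using Unitization.ind with
    | inl_add_inr c x =>
      have hΦ : Φ.toLin (algebraMap ℂ _ c) = c := by
        rw [Algebra.algebraMap_eq_smul_one, map_smul, Φ.map_one, smul_eq_mul, mul_one]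
      simp [unitalExtension, G, hΦ]
      rfl
  rw [moments, h]
  change RedFree.wordFunctional _ _ _ _
    (biFreeRep (deltaFunctional L₁ R₁) (tildeFunctional φ₂) (G (wordProd (w.map pairLetter))) 1) = _
  congr 2
  rw [wordProd, map_list_prod, map_list_prod]
  congr 1
  simp only [List.map_map]
  refine List.map_congr_left fun a _ => ?_
  simp [G, letterAction, embedUnital_regroup_letter]

/-- The vector of the free product of the spaces with specified vectors which is described by a
state of the moment recursion. -/
def realize : Phase (L₁ ⊕ R₁) (L₂ ⊕ R₂) →
    RedFree (deltaFunctional L₁ R₁).toPtSpace (tildeFunctional φ₂).toPtSpace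
  | .initial l => RedFree.embed' _ _ (unitalProd l)
  | .mixed c u x v => c • (RedFree.embed' _ _ (unitalProd u) *
      RedFree.inl _ _ ((deltaFunctional L₁ R₁).toPtSpace.proj (unitalProd x)) *
      RedFree.embed' _ _ (unitalProd v))

theorem letterAction_mem_locked (a : (L₁ ⊕ R₁) ⊕ (L₂ ⊕ R₂))
    {y : RedFree (deltaFunctional L₁ R₁).toPtSpace (tildeFunctional φ₂).toPtSpace}
    (hy : y ∈ RedFree.locked _ _) : letterAction φ₂ a y ∈ RedFree.locked _ _ := by
  rcases a with (a | a) | (a | a)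
  · rw [letterAction_inl_inl]
    exact RedFree.leftRep_mem_locked (fun x => deltaFunctional_unitalLetter_mul _ _) hy
  · rw [letterAction_inl_inr]
    exact RedFree.rightRep_mem_locked (fun x => deltaFunctional_unitalLetter_mul _ _) hy
  · rw [letterAction_inr_inl]
    exact RedFree.leftRep'_mem_locked _ hy
  · rw [letterAction_inr_inr]
    exact RedFree.rightRep'_mem_locked _ hy

theorem coe_proj_unitalProd {x : List (L₁ ⊕ R₁)} (hx : x ≠ []) :
    ((deltaFunctional L₁ R₁).toPtSpace.proj (unitalProd x) :
      FreeProd (Unitization ℂ L₁) (Unitization ℂ R₁)) = unitalProd x := by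
  rw [PtSpace.coe_proj]
  change _ - (deltaFunctional L₁ R₁).toLin (unitalProd x) • _ = _
  rw [deltaFunctional_unitalProd hx, zero_smul, sub_zero]

/-- A letter acts on the vectors described by the states as the moment recursion says, modulo
locked words. -/
theorem letterAction_realize (a : (L₁ ⊕ R₁) ⊕ (L₂ ⊕ R₂)) (p : Phase (L₁ ⊕ R₁) (L₂ ⊕ R₂))
    (hp : ∀ c u x v, p = .mixed c u x v → x ≠ []) :
    letterAction φ₂ a (realize φ₂ p) -
      realize φ₂ (Phase.step Sum.isLeft Sum.isLeft (moments φ₂) a p) ∈ RedFree.locked _ _ := by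
  set S := (deltaFunctional L₁ R₁).toPtSpace
  set T := (tildeFunctional φ₂).toPtSpace
  have hS (a : L₁ ⊕ R₁) (y) : S.state (Algebra.lmul ℂ _ (unitalLetter a) y) = 0 :=
    deltaFunctional_unitalLetter_mul a y
  have hT (l : List (L₂ ⊕ R₂)) : T.state (unitalProd l) = moments φ₂ l :=
    tildeFunctional_unitalProd φ₂ l
  have hvec (a : L₁ ⊕ R₁) : Algebra.lmul ℂ _ (unitalLetter a) S.vec = unitalProd [a] := by
    simp [unitalProd, S, UnitalFunctional.toPtSpace]
  have hker (a : L₁ ⊕ R₁) {x : List (L₁ ⊕ R₁)} (hx : x ≠ []) :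
      Algebra.lmul ℂ _ (unitalLetter a) (S.proj (unitalProd x)) = unitalProd (a :: x) :=
    congrArg (unitalLetter a * ·) (coe_proj_unitalProd hx)
  have hnil : RedFree.embed' S T (unitalProd []) = 1 := RedFree.embed'_vec S T
  have hcons (b : L₂ ⊕ R₂) (l : List (L₂ ⊕ R₂)) :
      Algebra.lmul ℂ _ (unitalLetter b) (unitalProd l) = unitalProd (b :: l) := rfl
  rcases p with l | ⟨c, u, x, v⟩
  · -- on the states without a letter of the first pair, the action is exact
    rcases a with (a | a) | (a | a)
    · rw [letterAction_inl_inl]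
      simp only [realize, Phase.step, Sum.isLeft, cond]
      rw [RedFree.leftRep_embed' (hS _ _), hvec, hnil, one_smul, one_mul, sub_self]
      exact zero_mem _
    · rw [letterAction_inl_inr]
      simp only [realize, Phase.step, Sum.isLeft, cond]
      rw [RedFree.rightRep_embed' (hS _ _), hvec, hnil, one_smul, mul_one, sub_self]
      exact zero_mem _
    · rw [letterAction_inr_inl]
      simp only [realize, Phase.step]
      rw [RedFree.leftRep'_embed', hcons, sub_self]
      exact zero_mem _
    · rw [letterAction_inr_inr]
      simp only [realize, Phase.step]
      rw [RedFree.rightRep'_embed', hcons, sub_self]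
      exact zero_mem _
  · have hx := hp _ _ _ _ rfl
    rcases a with (a | a) | (a | a)
    · rw [letterAction_inl_inl]
      simp only [realize, Phase.step, Sum.isLeft, cond]
      have := RedFree.leftRep_embed'_mul_inl (S.proj (unitalProd x)) (hS (.inl a) _)
        (hS (.inl a) _) (unitalProd u) (RedFree.embed' S T (unitalProd v))
      rw [hT, hker _ hx] at this
      rw [map_smul, hnil, one_mul, mul_smul, ← smul_sub, mul_assoc]
      exact Submodule.smul_mem _ _ this
    · rw [letterAction_inl_inr]
      simp only [realize, Phase.step, Sum.isLeft, cond]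
      have := RedFree.rightRep_mul_inl_mul_embed' (S.proj (unitalProd x)) (hS (.inr a) _)
        (hS (.inr a) _) (unitalProd v) (RedFree.embed' S T (unitalProd u))
      rw [hT, hker _ hx] at this
      rw [map_smul, hnil, mul_one, mul_smul, ← smul_sub]
      exact Submodule.smul_mem _ _ this
    · rw [letterAction_inr_inl]
      simp only [realize, Phase.step, Sum.isLeft, cond]
      rw [map_smul, mul_assoc, RedFree.leftRep'_embed'_mul_inl, hcons, ← mul_assoc, sub_self]
      exact zero_mem _
    · rw [letterAction_inr_inr]
      simp only [realize, Phase.step, Sum.isLeft, cond]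
      rw [map_smul, RedFree.rightRep'_mul_inl_mul_embed', hcons, sub_self]
      exact zero_mem _

theorem realize_run (w : List ((L₁ ⊕ R₁) ⊕ (L₂ ⊕ R₂))) :
    (w.map (letterAction φ₂)).prod 1 -
      realize φ₂ (Phase.run Sum.isLeft Sum.isLeft (moments φ₂) w) ∈ RedFree.locked _ _ := by
  induction w with
  | nil =>
    have : realize φ₂ (Phase.initial [] : Phase (L₁ ⊕ R₁) (L₂ ⊕ R₂)) = 1 :=
      RedFree.embed'_vec _ _
    simp [this]
  | cons a w ih =>
    have h := letterAction_mem_locked φ₂ a ih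
    have h' := letterAction_realize φ₂ a (Phase.run Sum.isLeft Sum.isLeft (moments φ₂) w)
      fun c u x v h => Phase.run_mixed_ne_nil _ _ _ h
    rw [map_sub] at h
    simpa using add_mem h h'

theorem wordFunctional_realize (p : Phase (L₁ ⊕ R₁) (L₂ ⊕ R₂))
    (hp : ∀ c u x v, p = .mixed c u x v → x ≠ []) :
    RedFree.wordFunctional _ _ (tildeFunctional φ₁).toLin (tildeFunctional φ₂).toLin
      (realize φ₂ p) = Phase.val (moments φ₁) (moments φ₂) p := by
  rcases p with l | ⟨c, u, x, v⟩
  · exact (RedFree.wordFunctional_embed' _ _).trans (tildeFunctional_unitalProd φ₂ l)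
  · rw [realize, map_smul]
    refine (congrArg (c • ·)
      (RedFree.wordFunctional_embed'_mul_inl_mul_embed' _ _ _ _)).trans ?_
    rw [coe_proj_unitalProd (hp _ _ _ _ rfl), tildeFunctional_unitalProd]
    change c * ((tildeFunctional φ₂).toLin _ * _ * (tildeFunctional φ₂).toLin _) = _
    rw [tildeFunctional_unitalProd, tildeFunctional_unitalProd, Phase.val]
    ring

/-- The moments of the bi-monotonic product are computed by the moment recursion. -/
theorem moments_pairProduct (w : List ((L₁ ⊕ R₁) ⊕ (L₂ ⊕ R₂))) :
    moments (pairProduct φ₁ φ₂) (w.map pairLetter) =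
      Phase.moment Sum.isLeft Sum.isLeft (moments φ₁) (moments φ₂) w := by
  have h := RedFree.wordFunctional_locked (tildeFunctional φ₁).toLin (realize_run φ₂ w)
  rw [map_sub, sub_eq_zero] at h
  rw [moments_pairProduct_eq_wordFunctional]
  exact h.trans (wordFunctional_realize φ₁ φ₂ _ fun c u x v h => Phase.run_mixed_ne_nil _ _ _ h)

end Letters

/-! ### Functionals are determined by their moments -/

section Generation

variable {A B : Type*}
  [NonUnitalRing A] [Module ℂ A] [IsScalarTower ℂ A A] [SMulCommClass ℂ A A]
  [NonUnitalRing B] [Module ℂ B] [IsScalarTower ℂ B B] [SMulCommClass ℂ B B]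

theorem NUFreeProd.eq_top_of_comap_eq_top {U : NonUnitalSubalgebra ℂ (NUFreeProd A B)}
    (hl : U.comap (NUFreeProd.inl : A →ₙₐ[ℂ] NUFreeProd A B) = ⊤)
    (hr : U.comap (NUFreeProd.inr : B →ₙₐ[ℂ] NUFreeProd A B) = ⊤) : U = ⊤ := by
  have hl' (a : A) : NUFreeProd.inl a ∈ U :=
    (NonUnitalSubalgebra.mem_comap _ _ _).1 (hl ▸ NonUnitalAlgebra.mem_top)
  have hr' (b : B) : NUFreeProd.inr b ∈ U :=
    (NonUnitalSubalgebra.mem_comap _ _ _).1 (hr ▸ NonUnitalAlgebra.mem_top)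
  refine NonUnitalAlgebra.eq_top_iff.2 fun x => ?_
  obtain ⟨x, hx⟩ := x
  induction hx using NonUnitalAlgebra.adjoin_induction with
  | mem x hx =>
    rcases hx with ⟨a, rfl⟩ | ⟨a, rfl⟩
    · exact hl' a
    · exact hr' a
  | add x y hx hy h h' => exact U.add_mem h h'
  | zero => exact U.zero_mem
  | mul x y hx hy h h' => exact U.mul_mem h h'
  | smul r x hx h => exact U.smul_mem r h

/-- Two functionals on `A ⊔ B` with the same moments on words in a set of letters which generates
`A ⊔ B` are equal. -/
theorem ext_of_moments {ι : Type*} (e : ι → A ⊕ B)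
    (he : NonUnitalAlgebra.adjoin ℂ (Set.range fun i => letter (e i)) = ⊤)
    {φ ψ : NUFreeProd A B →ₗ[ℂ] ℂ} (h : ∀ w : List ι, moments φ (w.map e) = moments ψ (w.map e)) :
    φ = ψ := by
  have hw {x} (hx : x ∈ Subsemigroup.closure (Set.range fun i => letter (e i))) :
      ∃ w : List ι, wordProd (w.map e) = (x : Unitization ℂ (NUFreeProd A B)) := by
    induction hx using Subsemigroup.closure_induction with
    | mem x hx =>
      obtain ⟨i, rfl⟩ := hx
      exact ⟨[i], by simp [wordProd]⟩
    | mul x y _ _ hx hy =>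
      obtain ⟨w, hw⟩ := hx
      obtain ⟨w', hw'⟩ := hy
      exact ⟨w ++ w', by simp [wordProd] at hw hw' ⊢; rw [hw, hw']⟩
  have hs : Submodule.span ℂ
      (Subsemigroup.closure (Set.range fun i => letter (e i)) : Set (NUFreeProd A B)) = ⊤ := by
    rw [← NonUnitalAlgebra.adjoin_eq_span, he]
    rfl
  refine LinearMap.ext_on hs fun x hx => ?_
  obtain ⟨w, hw⟩ := hw hx
  have := h w
  simpa [moments, hw, unitalExtension] using this

end Generation

/-! ### Associativity -/

section Assoc

variable {L₁ R₁ L₂ R₂ L₃ R₃ : Type*}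
  [NonUnitalRing L₁] [Module ℂ L₁] [IsScalarTower ℂ L₁ L₁] [SMulCommClass ℂ L₁ L₁]
  [NonUnitalRing R₁] [Module ℂ R₁] [IsScalarTower ℂ R₁ R₁] [SMulCommClass ℂ R₁ R₁]
  [NonUnitalRing L₂] [Module ℂ L₂] [IsScalarTower ℂ L₂ L₂] [SMulCommClass ℂ L₂ L₂]
  [NonUnitalRing R₂] [Module ℂ R₂] [IsScalarTower ℂ R₂ R₂] [SMulCommClass ℂ R₂ R₂]
  [NonUnitalRing L₃] [Module ℂ L₃] [IsScalarTower ℂ L₃ L₃] [SMulCommClass ℂ L₃ L₃]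
  [NonUnitalRing R₃] [Module ℂ R₃] [IsScalarTower ℂ R₃ R₃] [SMulCommClass ℂ R₃ R₃]

/-- The letters of three pairs of algebras, as letters of
`((L₁ ⊔ L₂) ⊔ L₃, (R₁ ⊔ R₂) ⊔ R₃)`. -/
def tripleLetter : ((L₁ ⊕ R₁) ⊕ (L₂ ⊕ R₂)) ⊕ (L₃ ⊕ R₃) →
    NUFreeProd (NUFreeProd L₁ L₂) L₃ ⊕ NUFreeProd (NUFreeProd R₁ R₂) R₃ :=
  pairLetter ∘ Sum.map pairLetter id

/-- The letters of three pairs of algebras, as letters of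
`(L₁ ⊔ (L₂ ⊔ L₃), R₁ ⊔ (R₂ ⊔ R₃))`. -/
def tripleLetter' : (L₁ ⊕ R₁) ⊕ ((L₂ ⊕ R₂) ⊕ (L₃ ⊕ R₃)) →
    NUFreeProd L₁ (NUFreeProd L₂ L₃) ⊕ NUFreeProd R₁ (NUFreeProd R₂ R₃) :=
  pairLetter ∘ Sum.map id pairLetter

theorem adjoin_tripleLetter : NonUnitalAlgebra.adjoin ℂ (Set.range fun a =>
    letter (tripleLetter (L₁ := L₁) (R₁ := R₁) (L₂ := L₂) (R₂ := R₂) (L₃ := L₃) (R₃ := R₃) a)) =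
      ⊤ := by
  have h (a) := NonUnitalAlgebra.subset_adjoin ℂ (Set.mem_range_self (f := fun a =>
    letter (tripleLetter (L₁ := L₁) (R₁ := R₁) (L₂ := L₂) (R₂ := R₂) (L₃ := L₃) (R₃ := R₃) a)) a)
  refine NUFreeProd.eq_top_of_comap_eq_top (NUFreeProd.eq_top_of_comap_eq_top
    (NUFreeProd.eq_top_of_comap_eq_top ?_ ?_) ?_) (NUFreeProd.eq_top_of_comap_eq_top
    (NUFreeProd.eq_top_of_comap_eq_top ?_ ?_) ?_) <;>
    refine NonUnitalAlgebra.eq_top_iff.2 fun a => ?_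
  · exact h (.inl (.inl (.inl a)))
  · exact h (.inl (.inr (.inl a)))
  · exact h (.inr (.inl a))
  · exact h (.inl (.inl (.inr a)))
  · exact h (.inl (.inr (.inr a)))
  · exact h (.inr (.inr a))

theorem pairAssoc_letter_tripleLetter (a : ((L₁ ⊕ R₁) ⊕ (L₂ ⊕ R₂)) ⊕ (L₃ ⊕ R₃)) :
    NUFreeProd.pairAssoc L₁ L₂ L₃ R₁ R₂ R₃ (letter (tripleLetter a)) =
      letter (tripleLetter' (Equiv.sumAssoc _ _ _ a)) := by
  rcases a with ((a | a) | (a | a)) | (a | a) <;>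
    simp [tripleLetter, tripleLetter', pairLetter, letter, NUFreeProd.pairAssoc, NUFreeProd.assoc]

theorem moments_comp_pairAssoc
    (φ : NUFreeProd (NUFreeProd L₁ (NUFreeProd L₂ L₃)) (NUFreeProd R₁ (NUFreeProd R₂ R₃)) →ₗ[ℂ] ℂ)
    (w : List (((L₁ ⊕ R₁) ⊕ (L₂ ⊕ R₂)) ⊕ (L₃ ⊕ R₃))) :
    moments (φ ∘ₗ (NUFreeProd.pairAssoc L₁ L₂ L₃ R₁ R₂ R₃ : _ →ₗ[ℂ] _)) (w.map tripleLetter) =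
      moments φ ((w.map (Equiv.sumAssoc _ _ _)).map tripleLetter') := by
  let G := Unitization.lift ((Unitization.inrNonUnitalAlgHom ℂ _).comp
    (NUFreeProd.pairAssoc L₁ L₂ L₃ R₁ R₂ R₃))
  have h : (unitalExtension (φ ∘ₗ (NUFreeProd.pairAssoc L₁ L₂ L₃ R₁ R₂ R₃ : _ →ₗ[ℂ] _))).toLin =
      (unitalExtension φ).toLin ∘ₗ G.toLinearMap := by
    refine LinearMap.ext fun y => ?_
    induction y using Unitization.ind with
    | inl_add_inr c x => simp [unitalExtension, G, Unitization.algebraMap_eq_inl]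
  rw [moments, moments, h]
  change (unitalExtension φ).toLin (G _) = _
  congr 1
  rw [wordProd, wordProd, map_list_prod]
  congr 1
  simp only [List.map_map]
  refine List.map_congr_left fun a _ => ?_
  simp [G, pairAssoc_letter_tripleLetter]

theorem isLeft_pairLetter :
    Sum.isLeft ∘ pairLetter (L₁ := L₁) (R₁ := R₁) (L₂ := L₂) (R₂ := R₂) =
      Sum.elim Sum.isLeft Sum.isLeft := by
  ext a
  rcases a with (a | a) | (a | a) <;> rfl

variable (φ₁ : NUFreeProd L₁ R₁ →ₗ[ℂ] ℂ) (φ₂ : NUFreeProd L₂ R₂ →ₗ[ℂ] ℂ)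
    (φ₃ : NUFreeProd L₃ R₃ →ₗ[ℂ] ℂ)

theorem moments_pairProduct_left (w : List (((L₁ ⊕ R₁) ⊕ (L₂ ⊕ R₂)) ⊕ (L₃ ⊕ R₃))) :
    moments (pairProduct (pairProduct φ₁ φ₂) φ₃) (w.map tripleLetter) =
      Phase.moment (Sum.elim Sum.isLeft Sum.isLeft) Sum.isLeft
        (Phase.moment Sum.isLeft Sum.isLeft (moments φ₁) (moments φ₂)) (moments φ₃) w := by
  rw [tripleLetter, ← List.map_map, moments_pairProduct, Phase.moment_map, isLeft_pairLetter]
  congr 1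
  · exact funext fun l => moments_pairProduct φ₁ φ₂ l
  · exact funext fun l => by simp

theorem moments_pairProduct_right (w : List ((L₁ ⊕ R₁) ⊕ ((L₂ ⊕ R₂) ⊕ (L₃ ⊕ R₃)))) :
    moments (pairProduct φ₁ (pairProduct φ₂ φ₃)) (w.map tripleLetter') =
      Phase.moment Sum.isLeft (Sum.elim Sum.isLeft Sum.isLeft) (moments φ₁)
        (Phase.moment Sum.isLeft Sum.isLeft (moments φ₂) (moments φ₃)) w := by
  rw [tripleLetter', ← List.map_map, moments_pairProduct, Phase.moment_map, isLeft_pairLetter]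
  congr 1
  · exact funext fun l => by simp
  · exact funext fun l => moments_pairProduct φ₂ φ₃ l

end Assoc

end BiMono

end

theorem mainTheorem1 {L₁ R₁ L₂ R₂ L₃ R₃ : Type*}
    [NonUnitalRing L₁] [Module ℂ L₁] [IsScalarTower ℂ L₁ L₁] [SMulCommClass ℂ L₁ L₁]
    [NonUnitalRing R₁] [Module ℂ R₁] [IsScalarTower ℂ R₁ R₁] [SMulCommClass ℂ R₁ R₁]
    [NonUnitalRing L₂] [Module ℂ L₂] [IsScalarTower ℂ L₂ L₂] [SMulCommClass ℂ L₂ L₂]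
    [NonUnitalRing R₂] [Module ℂ R₂] [IsScalarTower ℂ R₂ R₂] [SMulCommClass ℂ R₂ R₂]
    [NonUnitalRing L₃] [Module ℂ L₃] [IsScalarTower ℂ L₃ L₃] [SMulCommClass ℂ L₃ L₃]
    [NonUnitalRing R₃] [Module ℂ R₃] [IsScalarTower ℂ R₃ R₃] [SMulCommClass ℂ R₃ R₃]
    (φ₁ : BiMono.NUFreeProd L₁ R₁ →ₗ[ℂ] ℂ) (φ₂ : BiMono.NUFreeProd L₂ R₂ →ₗ[ℂ] ℂ)
    (φ₃ : BiMono.NUFreeProd L₃ R₃ →ₗ[ℂ] ℂ) :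
    BiMono.pairProduct (BiMono.pairProduct φ₁ φ₂) φ₃ =
      BiMono.pairProduct φ₁ (BiMono.pairProduct φ₂ φ₃) ∘ₗ
        (BiMono.NUFreeProd.pairAssoc L₁ L₂ L₃ R₁ R₂ R₃ : _ →ₗ[ℂ] _) := by
  refine BiMono.ext_of_moments BiMono.tripleLetter BiMono.adjoin_tripleLetter fun w => ?_
  rw [BiMono.moments_comp_pairAssoc, BiMono.moments_pairProduct_left,
    BiMono.moments_pairProduct_right]
  exact BiMono.Phase.moment_assoc _ _ _ _ _ _ (BiMono.moments_nil φ₂) w
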